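/- **Theorem 4.1.** *Setting.* Let $\dot x=Ax$ with $A\in\mathbb R^{n\times n}$, and let agents $i\in\mathcal V=\{1,\dots,N\}$ measure $y_i=H_ix$ with $H_i\in\mathbb R^{m_i\times n}$; let $H$ be the stacked matrix of $H_1,\dots,H_N$. For a pair $(A,C)$ the undetectable subspace is $\bigcap_{k=1}^n\ker(CA^{k-1})\cap\ker(F_A^+(A))$, where $F_A^+$ is the monic factor of the characteristic polynomial of $A$ whose roots are the roots in the closed right half-plane; $(A,C)$ is detectable if this subspace is $\{0\}$. Let $\mathcal G$ be an undirected graph on $\mathcal V$ without self-loops, with neighbor sets $\mathcal N_i$, $N_i=|\mathcal N_i|$, symmetric weights $a_{ij}>0$ if $j\in\mathcal N_i$ and $a_{ij}=0$ otherwise, and Laplacian $\mathcal L$ ($l_{ii}=\sum_{k\in\mathcal N_i}a_{ik}$, $l_{ij}=-a_{ij}$ for $i\ne j$). *Observer.* Let $\mathcal U_i$ be the undetectable subspace of $(A,H_i)$, $p_i=\dim\mathcal U_i$, let the columns of $D_i$ and $U_i$ be orthonormal bases of $\mathcal U_i^\perp$ and $\mathcal U_i$, $T_i=[D_i\ U_i]$,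 $A_{i\mathrm d}=D_i^{\mathrm T}AD_i$, $H_{i\mathrm d}=H_iD_i$, $A_{i\mathrm u}=U_i^{\mathrm T}AU_i$, $U=\mathrm{diag}\{U_i\}$, $A_{\mathrm u}=\mathrm{diag}\{A_{i\mathrm u}\}$. Choose $L_{i\mathrm d}$ with $A_{i\mathrm d}-L_{i\mathrm d}H_{i\mathrm d}$ Hurwitz, and set $L_i=T_i\begin{bmatrix}L_{i\mathrm d}\\0\end{bmatrix}$, $M_i=T_i\begin{bmatrix}0&0\\0&I_{p_i}\end{bmatrix}T_i^{\mathrm T}$. Choose $\epsilon\in(0,\tfrac12)$ and $$\check c\ \ge\ \frac{2+\|A_{\mathrm u}+A_{\mathrm u}^{\mathrm T}\|}{(1-2\epsilon)\,\lambda_{\min}\big(U^{\mathrm T}(\mathcal L\otimes I_n)U\big)}$$ (if all $p_i=0$, the right-hand side is read as $0$). The estimates obey $$\dot{\hat x}_i=A\hat x_i+L_i(y_i-H_i\hat x_i)-\check cM_i\sum_{j\in\mathcal N_i}a_{ij}(\bar x_{ij}-\bar x_{ji}),\qquad \bar x_{ij}(t)=e^{A(t-t_k^{ij})}\hat x_i(t_k^{ij})\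 \text{ for } t\in[t_k^{ij},t_{k+1}^{ij}).$$ *Trigger.* Let $0<\check\beta<1$, and for every directed edge let $\bar\tau_{ij},\delta_{ij},\kappa_{ij},\gamma_{ij},\rho_{ij}(0)$ be any positive constants. With $\tilde x_{ij}=\bar x_{ij}-\hat x_i$ and $\tilde x_{ij\mathrm u}=U_i^{\mathrm T}\tilde x_{ij}$, put $$f_{ij}=4a_{ij}\|\tilde x_{ij\mathrm u}\|^2-\frac{\check\beta}{N_i}\sum_{k\in\mathcal N_i}a_{ik}\|\bar x_{ik}-\bar x_{ki}\|^2-\kappa_{ij}\rho_{ij},$$ $$\dot\rho_{ij}=-\delta_{ij}\rho_{ij}-4a_{ij}\|\tilde x_{ij\mathrm u}\|^2+\frac{\check\beta}{N_i}\sum_{k\in\mathcal N_i}a_{ik}\|\bar x_{ik}-\bar x_{ki}\|^2+\gamma_{ij}\|H_i\hat x_i-y_i\|^2 .$$ The sampling instants of each directed edge $(i,j)$ are generated separately by $$t_0^{ij}=0,\qquad t_{k+1}^{ij}=\inf\{t>t_k^{ij}\mid f_{ij}(t)>0\ \lor\ t-t_k^{ij}\ge\bar\tau_{ij}\},$$ where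 edge $(i,j)$ holds its $k$-th sample in $f_{ij}$. This means: the condition is not met on $(t_k^{ij},t_{k+1}^{ij})$, and at $t_{k+1}^{ij}>t_k^{ij}$ either $\bar\tau_{ij}$ has elapsed or $f_{ij}$ has reached the boundary ($f_{ij}\ge0$) of the triggering region; if other edges sample at the same instant, $f_{ij}$ may be read there before or after their updates. Solutions $\hat x_i,\rho_{ij}$ are continuous on $[0,\infty)$ and satisfy the differential equations, as equations for right derivatives, at all times before any accumulation of sampling instants. *Claim.* Suppose that $\mathcal G$ is connected and $(A,H)$ is detectable. Then for every admissible choice of the design parameters there are constants $\lambda>0$ and $K\ge0$ such that every solution of the closed loop has $t_k^{ij}\to\infty$ as $k\to\infty$ for every edge (so that it is governed by the above equations on all of $[0,\infty)$), and its estimation errors $\eta_i=\hat x_i-x$ satisfy $$\|\eta_i(t)\|\le K\Big(\sum_{j\in\mathcal V}\|\eta_j(0)\|^2+\sum_{j\in\mathcal V}\sum_{k\in\mathcal N_j}\rho_{jk}(0)\Big)^{1/2}e^{-\lambda t}\qquad\text{for all } t\ge0,\ i\in\mathcal V.$$ In particular every estimation error converges to zero exponentially. -/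

import Mathlib

open scoped Matrix Kronecker Polynomial

noncomputable section

namespace EdgeObserver

/-! ### Detectability -/

/-- The monic factor `F⁺` of the characteristic polynomial of `A` whose roots are the eigenvalues
of `A` in the closed right half-plane, with multiplicity. (Its coefficients are real, but it is
kept as a complex polynomial.) -/
def unstableFactor {n : ℕ} (A : Matrix (Fin n) (Fin n) ℝ) : ℂ[X] :=
  open scoped Classical in
  (((A.map Complex.ofReal).charpoly.roots.filter (fun z : ℂ => 0 ≤ z.re)).map
    (fun z => Polynomial.X - Polynomial.C z)).prod

/-- The undetectable subspace `⋂ₖ ker (H Aᵏ⁻¹) ∩ ker F⁺(A)`, `k = 1, …, n`, of the pair `(A, H)`. -/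
def undetectableSubspace {n : ℕ} {r : Type*} (A : Matrix (Fin n) (Fin n) ℝ)
    (H : Matrix r (Fin n) ℝ) : Submodule ℝ (EuclideanSpace ℝ (Fin n)) where
  carrier := {v | (∀ k < n, (H * A ^ k) *ᵥ v.ofLp = 0) ∧
    (Polynomial.aeval (A.map Complex.ofReal) (unstableFactor A)) *ᵥ
      (fun s => (v s : ℂ)) = 0}
  add_mem' := by
    rintro v w ⟨hv, hv'⟩ ⟨hw, hw'⟩
    refine ⟨fun k hk => ?_, ?_⟩
    · rw [WithLp.ofLp_add, Matrix.mulVec_add, hv k hk, hw k hk, add_zero]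
    · have : (fun s => (((v + w) s : ℝ) : ℂ)) = (fun s => (v s : ℂ)) + fun s => (w s : ℂ) := by
        ext s; simp
      rw [this, Matrix.mulVec_add, hv', hw', add_zero]
  zero_mem' := by
    refine ⟨fun k _ => by simp, ?_⟩
    have : (fun s => (((0 : EuclideanSpace ℝ (Fin n)) s : ℝ) : ℂ)) = 0 := by
      ext s; simp
    rw [this, Matrix.mulVec_zero]
  smul_mem' := by
    rintro c v ⟨hv, hv'⟩
    refine ⟨fun k hk => ?_, ?_⟩
    · rw [WithLp.ofLp_smul, Matrix.mulVec_smul, hv k hk, smul_zero]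
    · have : (fun s => (((c • v) s : ℝ) : ℂ)) = (c : ℂ) • fun s => (v s : ℂ) := by
        ext s; simp
      rw [this, Matrix.mulVec_smul, hv', smul_zero]

/-- The pair `(A, H)` is detectable. -/
def IsDetectable {n : ℕ} {r : Type*} (A : Matrix (Fin n) (Fin n) ℝ)
    (H : Matrix r (Fin n) ℝ) : Prop :=
  undetectableSubspace A H = ⊥

/-- The dimension of the undetectable subspace. -/
def undetDim {n : ℕ} {r : Type*} (A : Matrix (Fin n) (Fin n) ℝ) (H : Matrix r (Fin n) ℝ) : ℕ :=
  Module.finrank ℝ (undetectableSubspace A H)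

/-- The stacked measurement matrix `H = col {Hᵢ}`. -/
def stack {N n : ℕ} {m : Fin N → ℕ} (H : ∀ i, Matrix (Fin (m i)) (Fin n) ℝ) :
    Matrix ((i : Fin N) × Fin (m i)) (Fin n) ℝ :=
  Matrix.of fun q s => H q.1 q.2 s

/-! ### Matrices -/

/-- All complex eigenvalues have negative real part. -/
def IsHurwitz {κ : Type*} [Fintype κ] [DecidableEq κ] (M : Matrix κ κ ℝ) : Prop :=
  ∀ z ∈ spectrum ℂ (M.map Complex.ofReal), z.re < 0

/-- The columns of `B` form an orthonormal basis of the subspace `W`. -/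
def IsOrthonormalBasisOf {n : ℕ} {κ : Type*} (B : Matrix (Fin n) κ ℝ)
    (W : Submodule ℝ (EuclideanSpace ℝ (Fin n))) : Prop :=
  Orthonormal ℝ (fun k => WithLp.toLp 2 (B.col k)) ∧
    Submodule.span ℝ (Set.range fun k => WithLp.toLp 2 (B.col k)) = W

/-- The induced 2-norm of a square matrix. -/
def specNorm {κ : Type*} [Fintype κ] [DecidableEq κ] (M : Matrix κ κ ℝ) : ℝ :=
  ‖Matrix.toEuclideanCLM (n := κ) (𝕜 := ℝ) M‖

/-- The smallest eigenvalue of a real symmetric matrix. -/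
def lambdaMin {κ : Type*} [Fintype κ] [DecidableEq κ] (M : Matrix κ κ ℝ) : ℝ :=
  sInf (spectrum ℝ M)

/-! ### The communication graph -/

/-- `a` is a weighted adjacency matrix of the undirected graph `G`. -/
structure IsAdjacencyMatrix {N : ℕ} (G : SimpleGraph (Fin N)) (a : Matrix (Fin N) (Fin N) ℝ) :
    Prop where
  symm : ∀ i j, a i j = a j i
  pos : ∀ i j, G.Adj i j → 0 < a i j
  zero : ∀ i j, ¬ G.Adj i j → a i j = 0

/-- The weighted Laplacian. -/
def laplacian {N : ℕ} (G : SimpleGraph (Fin N)) [DecidableRel G.Adj]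
    (a : Matrix (Fin N) (Fin N) ℝ) : Matrix (Fin N) (Fin N) ℝ :=
  Matrix.of fun i j => if i = j then ∑ k ∈ G.neighborFinset i, a i k else - a i j

/-! ### The observer and its parameters -/

section Design

variable {N n : ℕ} {m : Fin N → ℕ}

/-- `A_u = diag {A_{iu}}`, where `A_{iu} = Uᵢᵀ A Uᵢ`. -/
def blockAu {p : Fin N → ℕ} (A : Matrix (Fin n) (Fin n) ℝ)
    (U : ∀ i, Matrix (Fin n) (Fin (p i)) ℝ) :
    Matrix ((i : Fin N) × Fin (p i)) ((i : Fin N) × Fin (p i)) ℝ :=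
  Matrix.blockDiagonal' fun i => (U i)ᵀ * A * U i

/-- The block diagonal matrix `U = diag {Uᵢ}`; rows are indexed by (agent, coordinate). -/
def blockU {p : Fin N → ℕ} (U : ∀ i, Matrix (Fin n) (Fin (p i)) ℝ) :
    Matrix (Fin N × Fin n) ((i : Fin N) × Fin (p i)) ℝ :=
  Matrix.of fun r q => if r.1 = q.1 then U q.1 r.2 q.2 else 0

/-- A choice of everything that the designer is free to choose in the edge-based observer and in
the edge-based dynamic event-triggering mechanism, within the prescribed ranges. -/
structure Design (A : Matrix (Fin n) (Fin n) ℝ) (H : ∀ i, Matrix (Fin (m i)) (Fin n) ℝ)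
    (G : SimpleGraph (Fin N)) [DecidableRel G.Adj] (a : Matrix (Fin N) (Fin N) ℝ) where
  /-- orthonormal bases of the orthogonal complements of the undetectable subspaces -/
  D : ∀ i, Matrix (Fin n) (Fin (n - undetDim A (H i))) ℝ
  /-- orthonormal bases of the undetectable subspaces -/
  U : ∀ i, Matrix (Fin n) (Fin (undetDim A (H i))) ℝ
  D_basis : ∀ i, IsOrthonormalBasisOf (D i) (undetectableSubspace A (H i))ᗮ
  U_basis : ∀ i, IsOrthonormalBasisOf (U i) (undetectableSubspace A (H i))
  /-- the gains of the detectable parts -/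
  Ld : ∀ i, Matrix (Fin (n - undetDim A (H i))) (Fin (m i)) ℝ
  /-- `A_{id} - L_{id} H_{id}` is Hurwitz, where `A_{id} = Dᵢᵀ A Dᵢ` and `H_{id} = Hᵢ Dᵢ` -/
  hurwitz : ∀ i, IsHurwitz ((D i)ᵀ * A * D i - Ld i * (H i * D i))
  /-- the constant `ε` -/
  eps : ℝ
  eps_pos : 0 < eps
  eps_lt : eps < 1 / 2
  /-- the coupling gain -/
  c : ℝ
  c_ge : (2 + specNorm (blockAu A U + (blockAu A U)ᵀ)) /
    ((1 - 2 * eps) * lambdaMin ((blockU U)ᵀ *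
      (laplacian G a ⊗ₖ (1 : Matrix (Fin n) (Fin n) ℝ)) * blockU U)) ≤ c
  /-- the constant `β` of the trigger -/
  beta : ℝ
  beta_pos : 0 < beta
  beta_lt : beta < 1
  /-- the maximal inter-event times -/
  tauMax : Fin N → Fin N → ℝ
  tauMax_pos : ∀ i j, G.Adj i j → 0 < tauMax i j
  delta : Fin N → Fin N → ℝ
  delta_pos : ∀ i j, G.Adj i j → 0 < delta i j
  kappa : Fin N → Fin N → ℝ
  kappa_pos : ∀ i j, G.Adj i j → 0 < kappa i j
  gamma : Fin N → Fin N → ℝ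
  gamma_pos : ∀ i j, G.Adj i j → 0 < gamma i j

variable {A : Matrix (Fin n) (Fin n) ℝ} {H : ∀ i, Matrix (Fin (m i)) (Fin n) ℝ}
  {G : SimpleGraph (Fin N)} [DecidableRel G.Adj] {a : Matrix (Fin N) (Fin N) ℝ}

/-- The orthogonal matrix `Tᵢ = [Dᵢ Uᵢ]`. -/
def Design.T (d : Design A H G a) (i : Fin N) :
    Matrix (Fin n) (Fin (n - undetDim A (H i)) ⊕ Fin (undetDim A (H i))) ℝ :=
  Matrix.fromCols (d.D i) (d.U i)

/-- The gain `Lᵢ = Tᵢ [L_{id}; 0]`. -/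
def Design.L (d : Design A H G a) (i : Fin N) : Matrix (Fin n) (Fin (m i)) ℝ :=
  d.T i * (Matrix.fromRows (d.Ld i) 0 :
    Matrix (Fin (n - undetDim A (H i)) ⊕ Fin (undetDim A (H i))) (Fin (m i)) ℝ)

/-- The gain `Mᵢ = Tᵢ diag(0, I) Tᵢᵀ`. -/
def Design.M (d : Design A H G a) (i : Fin N) : Matrix (Fin n) (Fin n) ℝ :=
  d.T i * (Matrix.fromBlocks 0 0 0 1 :
    Matrix (Fin (n - undetDim A (H i)) ⊕ Fin (undetDim A (H i)))
      (Fin (n - undetDim A (H i)) ⊕ Fin (undetDim A (H i))) ℝ) * (d.T i)ᵀ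

/-- `∑_{k ∈ Nᵢ} a_{ik} ‖z_{ik} - z_{ki}‖²` for given sample values `z`. -/
def disagreement (G : SimpleGraph (Fin N)) [DecidableRel G.Adj] (a : Matrix (Fin N) (Fin N) ℝ)
    (z : Fin N → Fin N → EuclideanSpace ℝ (Fin n)) (i : Fin N) : ℝ :=
  ∑ k ∈ G.neighborFinset i, a i k * ‖z i k - z k i‖ ^ 2

/-- `4 a_{ij} ‖(z_{ij} - w)_u‖²`, where `w` is the estimate of agent `i`. The undetectable part
of a vector `v = Tᵢ [v_d; v_u]` is `v_u = Uᵢᵀ v`, because `Tᵢ` is orthogonal. -/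
def Design.sampleError (d : Design A H G a) (z : Fin N → Fin N → EuclideanSpace ℝ (Fin n))
    (w : EuclideanSpace ℝ (Fin n)) (i j : Fin N) : ℝ :=
  4 * a i j * ‖Matrix.toEuclideanLin (d.U i)ᵀ (z i j - w)‖ ^ 2

/-- The trigger function `f_{ij}`, for sample values `z`, the estimate `w` of agent `i` and the
value `r` of `ρ_{ij}`. -/
def Design.trigger (d : Design A H G a) (z : Fin N → Fin N → EuclideanSpace ℝ (Fin n))
    (w : EuclideanSpace ℝ (Fin n)) (r : ℝ) (i j : Fin N) : ℝ :=
  d.sampleError z w i j - d.beta / (G.degree i : ℝ) * disagreement G a z i - d.kappa i j * r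

/-! ### The closed loop -/

/-- The signals of the closed loop. -/
structure Signals (N n : ℕ) where
  /-- the state of the system -/
  x : ℝ → EuclideanSpace ℝ (Fin n)
  /-- the estimates of the agents -/
  xhat : Fin N → ℝ → EuclideanSpace ℝ (Fin n)
  /-- the auxiliary variables of the directed edges -/
  rho : Fin N → Fin N → ℝ → ℝ
  /-- the sampling instants of the directed edges -/
  ts : Fin N → Fin N → ℕ → ℝ
  /-- the sample-based predictions of the directed edges -/
  xbar : Fin N → Fin N → ℝ → EuclideanSpace ℝ (Fin n)

/-- The prediction for time `t` from the `k`-th sample of edge `(i,j)`: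
`e^{A (t - t_k)} x̂ᵢ(t_k)`. -/
def Signals.held (S : Signals N n) (A : Matrix (Fin n) (Fin n) ℝ) (i j : Fin N) (k : ℕ) (t : ℝ) :
    EuclideanSpace ℝ (Fin n) :=
  Matrix.toEuclideanLin (NormedSpace.exp ((t - S.ts i j k) • A)) (S.xhat i (S.ts i j k))

/-- The time `t` lies before any accumulation of sampling instants. -/
def Signals.Reached (S : Signals N n) (G : SimpleGraph (Fin N)) (t : ℝ) : Prop :=
  ∀ l q, G.Adj l q → ∃ k, t < S.ts l q k

/-- `z` is a possible set of sample values seen at time `t` by the trigger of edge `(i,j)` whose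
last sample is the `k`-th one: edge `(i,j)` holds its `k`-th sample; every other edge shows its
current prediction or, if it takes a new sample exactly at time `t`, possibly still the prediction
from the sample before. -/
def Signals.Visible (S : Signals N n) (A : Matrix (Fin n) (Fin n) ℝ) (i j : Fin N) (k : ℕ) (t : ℝ)
    (z : Fin N → Fin N → EuclideanSpace ℝ (Fin n)) : Prop :=
  z i j = S.held A i j k t ∧
    ∀ l q, (l, q) ≠ (i, j) → z l q = S.xbar l q t ∨
      ∃ s, S.ts l q (s + 1) = t ∧ z l q = S.held A l q s t

/-- `S` is a solution of the closed loop on `[0, ∞)`. The differential equations have right-hand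
sides that jump at the sampling instants, so they are understood as equations for the right
derivatives of continuous functions. They are only imposed before any accumulation of sampling
instants, so that the absence of such accumulations is not part of the definition. -/
structure IsClosedLoop (d : Design A H G a) (S : Signals N n) : Prop where
  /-- the system `ẋ = A x` -/
  plant : ∀ t, 0 ≤ t →
    HasDerivWithinAt S.x (Matrix.toEuclideanLin A (S.x t)) (Set.Ici 0) t
  xhat_cont : ∀ i, ContinuousOn (S.xhat i) (Set.Ici 0)
  /-- the observer, with `yᵢ = Hᵢ x` -/
  observer : ∀ i t, 0 ≤ t → S.Reached G t →
    HasDerivWithinAt (S.xhat i)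
      (Matrix.toEuclideanLin A (S.xhat i t)
        + Matrix.toEuclideanLin (d.L i)
            (Matrix.toEuclideanLin (H i) (S.x t) - Matrix.toEuclideanLin (H i) (S.xhat i t))
        - d.c • Matrix.toEuclideanLin (d.M i)
            (∑ j ∈ G.neighborFinset i, a i j • (S.xbar i j t - S.xbar j i t)))
      (Set.Ici t) t
  rho_cont : ∀ i j, G.Adj i j → ContinuousOn (S.rho i j) (Set.Ici 0)
  rho_init : ∀ i j, G.Adj i j → 0 < S.rho i j 0
  /-- the dynamics of the auxiliary variables -/
  rho_deriv : ∀ i j, G.Adj i j → ∀ t, 0 ≤ t → S.Reached G t →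
    HasDerivWithinAt (S.rho i j)
      (- d.delta i j * S.rho i j t
        - d.sampleError (fun l q => S.xbar l q t) (S.xhat i t) i j
        + d.beta / (G.degree i : ℝ) * disagreement G a (fun l q => S.xbar l q t) i
        + d.gamma i j *
          ‖Matrix.toEuclideanLin (H i) (S.xhat i t) - Matrix.toEuclideanLin (H i) (S.x t)‖ ^ 2)
      (Set.Ici t) t
  /-- the predictions between sampling instants -/
  xbar_eq : ∀ i j, G.Adj i j → ∀ k, ∀ t ∈ Set.Ico (S.ts i j k) (S.ts i j (k + 1)),
    S.xbar i j t = S.held A i j k t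
  ts_zero : ∀ i j, G.Adj i j → S.ts i j 0 = 0
  ts_lt : ∀ i j, G.Adj i j → ∀ k, S.ts i j k < S.ts i j (k + 1)
  /-- between consecutive sampling instants the triggering condition
  `f_{ij}(t) > 0 ∨ t - t_k ≥ τ̄_{ij}` is not met -/
  not_before : ∀ i j, G.Adj i j → ∀ k, ∀ t ∈ Set.Ioo (S.ts i j k) (S.ts i j (k + 1)),
    ¬ (0 < d.trigger (fun l q => S.xbar l q t) (S.xhat i t) (S.rho i j t) i j ∨
      d.tauMax i j ≤ t - S.ts i j k)
  /-- a new sample is taken only when the elapsed time has reached `τ̄_{ij}` or `f_{ij}` has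
  reached the boundary of the region `f_{ij} > 0`. If other edges take samples at the same instant,
  `f_{ij}` may be read before or after their updates. -/
  fires : ∀ i j, G.Adj i j → ∀ k,
    d.tauMax i j ≤ S.ts i j (k + 1) - S.ts i j k ∨
      ∃ z, S.Visible A i j k (S.ts i j (k + 1)) z ∧
        0 ≤ d.trigger z (S.xhat i (S.ts i j (k + 1))) (S.rho i j (S.ts i j (k + 1))) i j

end Design

end EdgeObserver

end

/-!
The undetectable subspace `𝒰ᵢ` of agent `i` is `A`-invariant and is annihilated by `Hᵢ`, the gain
`Lᵢ` has its range in `𝒰ᵢᗮ`, and `Mᵢ` is the orthogonal projection onto `𝒰ᵢ`. Hence the detectable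
component `Dᵢᵀ ηᵢ` of the estimation error obeys the autonomous Hurwitz equation with matrix
`A_{id} - L_{id} H_{id}`, whatever the edges sample, and decays exponentially. Since samples are at
most `τ̄_{ij}` old, the same holds for `Dᵢᵀ (x̄_{ij} - x)` (`exists_detPart_decay`).

For the undetectable components use `W = ∑ ‖Uᵢᵀ ηᵢ‖² + (c / 2) ∑ ρ_{ij}`. Let `qᵢ` be the
projection of `ηᵢ` onto `𝒰ᵢ`; then `x̄_{ij} - x̄_{ji} = (qᵢ + r_{ij}) - (qⱼ + r_{ji})`, where `r_{ij}`
is the orthogonal sum of the undetectable part of the sample error and the detectable part of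
`x̄_{ij} - x`. Polarization (`neg_two_mul_sum_inner_le`) bounds the coupling term by minus the
disagreement energy of `q`, minus the disagreement of the predictions, plus `∑ a_{ij} ‖r_{ij}‖²`.
The first dominates the unstable drift by the choice of `c` (`coupling_gain`, where joint
detectability and connectedness make the reduced Laplacian positive definite); the others are
compensated by `∑ ρ̇_{ij}` because `β < 1` (`IsClosedLoop.sum_rhoRate_le`), up to exponentially
decaying terms. So `Ẇ ≤ -μ W + K e^{-2lt}` (`exists_undetPart_decay`).

All this needs `ρ_{ij} > 0`, which holds because `ρ̇_{ij} ≥ -(δ_{ij} + κ_{ij}) ρ_{ij}` as long as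
the trigger function is nonpositive (`IsClosedLoop.rho_pos_of_reached`), and the absence of
accumulations of sampling instants (`IsClosedLoop.tendsto_ts`): at the first accumulation point
`T`, of edge `(i,j)` say, the sample error read by the trigger of that edge would tend to zero by
continuity, while it must be at least `κ_{ij} ρ_{ij}`, which tends to `κ_{ij} ρ_{ij}(T) > 0`.
-/

namespace EdgeObserver

/-! ### Finite families of constants -/

/-- Finitely many positive numbers have a positive lower bound. -/
lemma exists_pos_forall_le {ι : Type*} [Finite ι] (P : ι → Prop) (f : ι → ℝ)
    (h : ∀ i, P i → 0 < f i) : ∃ e : ℝ, 0 < e ∧ ∀ i, P i → e ≤ f i := by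
  classical
  have := Fintype.ofFinite ι
  by_cases hne : (Finset.univ.filter P).Nonempty
  · obtain ⟨i, hi, hmin⟩ := Finset.exists_min_image _ f hne
    exact ⟨f i, h i (by simpa using hi), fun j hj => hmin j (by simpa using hj)⟩
  · refine ⟨1, one_pos, fun i hi => (hne ⟨i, by simpa using hi⟩).elim⟩

/-- Finitely many numbers have a nonnegative upper bound. -/
lemma exists_nonneg_forall_ge {ι : Type*} [Finite ι] (f : ι → ℝ) :
    ∃ C : ℝ, 0 ≤ C ∧ ∀ i, f i ≤ C := by
  obtain ⟨C, hC⟩ := (Set.finite_range f).bddAbove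
  exact ⟨max C 0, le_max_right _ _, fun i => (hC ⟨i, rfl⟩).trans (le_max_left _ _)⟩

/-! ### Decay of solutions of Hurwitz systems -/

lemma hasDerivWithinAt_linearMap_comp {E F : Type*} [NormedAddCommGroup E] [NormedSpace ℝ E]
    [FiniteDimensional ℝ E] [NormedAddCommGroup F] [NormedSpace ℝ F] (f : E →ₗ[ℝ] F)
    {y : ℝ → E} {y' : E} {s : Set ℝ} {t : ℝ} (h : HasDerivWithinAt y y' s t) :
    HasDerivWithinAt (fun t => f (y t)) (f y') s t :=
  (LinearMap.toContinuousLinearMap f).hasFDerivAt.comp_hasDerivWithinAt t h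

lemma continuousOn_linearMap_comp {E F : Type*} [NormedAddCommGroup E] [NormedSpace ℝ E]
    [FiniteDimensional ℝ E] [NormedAddCommGroup F] [NormedSpace ℝ F] (f : E →ₗ[ℝ] F)
    {y : ℝ → E} {s : Set ℝ} (h : ContinuousOn y s) :
    ContinuousOn (fun t => f (y t)) s :=
  (LinearMap.toContinuousLinearMap f).continuous.comp_continuousOn h

/-- A solution of `ẏ = μ y + z` decays at the rate `l < -Re μ` if `z` does. -/
lemma norm_le_of_scalar_ode {E : Type*} [NormedAddCommGroup E] [NormedSpace ℂ E]
    {μ : ℂ} {l K : ℝ} (hμ : μ.re < -l) {y z : ℝ → E}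
    (hy : ContinuousOn y (Set.Ici 0))
    (hy' : ∀ t, 0 ≤ t → HasDerivWithinAt y (μ • y t + z t) (Set.Ici t) t)
    (hz : ∀ t, 0 ≤ t → ‖z t‖ ≤ K * Real.exp (-l * t)) (hK : 0 ≤ K) :
    ∀ t, 0 ≤ t → ‖y t‖ ≤ (‖y 0‖ + K / (-l - μ.re)) * Real.exp (-l * t) := by
  intro T hT
  set ν : ℝ := -l - μ.re with hν
  have hν0 : 0 < ν := by linarith
  have hexp : ∀ t : ℝ, HasDerivAt (fun t : ℝ => Complex.exp (-μ * t)) (Complex.exp (-μ * t) * -μ) t := by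
    intro t
    have h1 : HasDerivAt (fun t : ℝ => -μ * (t : ℂ)) (-μ) t := by
      simpa using (Complex.ofRealCLM.hasDerivAt (x := t)).const_mul (-μ)
    exact h1.cexp
  have hnexp : ∀ t : ℝ, ‖Complex.exp (-μ * t)‖ = Real.exp (-μ.re * t) := by
    intro t
    rw [Complex.norm_exp]; simp
  -- variation of constants: `w = e^{-μ t} y` has derivative `e^{-μ t} z`
  have hw := image_norm_le_of_norm_deriv_right_le_deriv_boundary'
    (f := fun t : ℝ => Complex.exp (-μ * t) • y t) (f' := fun t => Complex.exp (-μ * t) • z t)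
    (a := 0) (b := T) (B := fun t => (‖y 0‖ + K / ν) * Real.exp (ν * t))
    (B' := fun t => (‖y 0‖ + K / ν) * (Real.exp (ν * t) * ν))
    (by
      refine ContinuousOn.smul ?_ (hy.mono Set.Icc_subset_Ici_self)
      exact fun t _ => (hexp t).continuousAt.continuousWithinAt)
    (by
      intro t ht
      have := (hexp t).hasDerivWithinAt (s := Set.Ici t) |>.smul (hy' t ht.1)
      refine this.congr_deriv ?_
      rw [smul_add, mul_smul, neg_smul, smul_neg]
      abel)
    (by
      simp only [Complex.ofReal_zero, mul_zero, Complex.exp_zero, one_smul, Real.exp_zero, mul_one]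
      exact le_add_of_nonneg_right (by positivity))
    (by fun_prop)
    (by
      intro t _
      have h1 : HasDerivAt (fun t : ℝ => ν * t) ν t := by
        simpa using (hasDerivAt_id t).const_mul ν
      exact (h1.exp.const_mul _).hasDerivWithinAt)
    (by
      intro t ht
      rw [norm_smul, hnexp]
      have h1 : Real.exp (-μ.re * t) * ‖z t‖ ≤ Real.exp (-μ.re * t) * (K * Real.exp (-l * t)) := by
        gcongr; exact hz t ht.1
      have h2 : Real.exp (-μ.re * t) * (K * Real.exp (-l * t)) = K * Real.exp (ν * t) := by
        rw [mul_left_comm, ← Real.exp_add]; congr 2; rw [hν]; ring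
      have h3 : (‖y 0‖ + K / ν) * (Real.exp (ν * t) * ν)
          = ‖y 0‖ * Real.exp (ν * t) * ν + K * Real.exp (ν * t) := by
        field_simp
      have h4 : 0 ≤ ‖y 0‖ * Real.exp (ν * t) * ν := by positivity
      linarith)
  have h := hw (Set.right_mem_Icc.2 hT)
  rw [norm_smul, hnexp] at h
  have h5 : ‖y T‖ = Real.exp (μ.re * T) * (Real.exp (-μ.re * T) * ‖y T‖) := by
    rw [← mul_assoc, ← Real.exp_add]; simp
  have h6 : Real.exp (μ.re * T) * ((‖y 0‖ + K / ν) * Real.exp (ν * T))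
      = (‖y 0‖ + K / ν) * Real.exp (-l * T) := by
    rw [mul_left_comm, ← Real.exp_add]; congr 2; rw [hν]; ring
  rw [h5, ← h6]
  gcongr

/-- Solutions of `ẏ = M y` that are annihilated by `∏ (M - μ)`, with all `Re μ < -l`, decay at the
rate `l`. -/
lemma exists_decay_of_annihilated {E : Type*} [NormedAddCommGroup E] [NormedSpace ℂ E]
    (M : E →L[ℂ] E) (l : ℝ) (s : Multiset ℂ) (hs : ∀ μ ∈ s, μ.re < -l) :
    ∃ C : ℝ, 0 ≤ C ∧ ∀ y : ℝ → E, ContinuousOn y (Set.Ici 0) →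
      (∀ t, 0 ≤ t → HasDerivWithinAt y (M (y t)) (Set.Ici t) t) →
      (∀ t, 0 ≤ t → Polynomial.aeval M
        (s.map fun μ => Polynomial.X - Polynomial.C μ).prod (y t) = 0) →
      ∀ t, 0 ≤ t → ‖y t‖ ≤ C * ‖y 0‖ * Real.exp (-l * t) := by
  induction s using Multiset.induction_on with
  | empty =>
    refine ⟨0, le_rfl, fun y _ _ h t ht => ?_⟩
    have := h t ht
    simp only [Multiset.map_zero, Multiset.prod_zero, map_one, one_apply_eq_self]
      at this
    simp [this]
  | cons μ s ih =>
    obtain ⟨C, hC, h⟩ := ih fun ν hν => hs ν (Multiset.mem_cons_of_mem hν)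
    have hμ := hs μ (Multiset.mem_cons_self μ s)
    have hν : 0 < -l - μ.re := by linarith
    set Z : E →L[ℂ] E := M - algebraMap ℂ (E →L[ℂ] E) μ with hZ
    have hZa : ∀ v, Z v = M v - μ • v := fun v => by
      simp [hZ, Algebra.algebraMap_eq_smul_one]
    refine ⟨1 + C * ‖Z‖ / (-l - μ.re), by positivity, fun y hy hy' h0 t ht => ?_⟩
    have hz := h (fun t => Z (y t)) (Z.continuous.comp_continuousOn hy)
      (fun t ht => by
        have := (Z.restrictScalars ℝ).hasFDerivAt.comp_hasDerivWithinAt t (hy' t ht)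
        refine this.congr_deriv ?_
        simp [hZa])
      (fun t ht => by
        have := h0 t ht
        rw [Multiset.map_cons, Multiset.prod_cons, mul_comm, map_mul] at this
        simpa [hZ] using this)
    have := norm_le_of_scalar_ode hμ hy (z := fun t => Z (y t)) (K := C * ‖Z (y 0)‖)
      (fun t ht => (hy' t ht).congr_deriv (by simp [hZa])) hz (by positivity) t ht
    refine this.trans ?_
    gcongr
    have h1 : ‖Z (y 0)‖ ≤ ‖Z‖ * ‖y 0‖ := Z.le_opNorm _
    have h2 : C * ‖Z (y 0)‖ / (-l - μ.re) ≤ C * (‖Z‖ * ‖y 0‖) / (-l - μ.re) := by gcongr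
    calc _ ≤ ‖y 0‖ + C * (‖Z‖ * ‖y 0‖) / (-l - μ.re) := by gcongr
      _ = _ := by ring

/-- `M` is exponentially stable with rate `l` and overshoot `C`: every solution of `ẏ = M y`, in
the sense of right derivatives, satisfies `‖y t‖ ≤ C ‖y 0‖ e^{-l t}`. -/
def DecaysAt {κ : Type*} [Fintype κ] [DecidableEq κ] (M : Matrix κ κ ℝ) (l C : ℝ) : Prop :=
  ∀ y : ℝ → EuclideanSpace ℝ κ, ContinuousOn y (Set.Ici 0) →
    (∀ t, 0 ≤ t → HasDerivWithinAt y (Matrix.toEuclideanLin M (y t)) (Set.Ici t) t) →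
    ∀ t, 0 ≤ t → ‖y t‖ ≤ C * ‖y 0‖ * Real.exp (-l * t)

lemma DecaysAt.mono {κ : Type*} [Fintype κ] [DecidableEq κ] {M : Matrix κ κ ℝ} {l l' C C' : ℝ}
    (h : DecaysAt M l C) (hC : 0 ≤ C) (hl : l' ≤ l) (hCC : C ≤ C') : DecaysAt M l' C' := by
  intro y hy hy' t ht
  refine (h y hy hy' t ht).trans ?_
  have : Real.exp (-l * t) ≤ Real.exp (-l' * t) := by
    apply Real.exp_le_exp.2
    nlinarith
  have hC' : 0 ≤ C' := hC.trans hCC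
  gcongr

/-- The coordinatewise inclusion of real into complex Euclidean space. -/
def complexify (κ : Type*) : EuclideanSpace ℝ κ →ₗ[ℝ] EuclideanSpace ℂ κ where
  toFun v := WithLp.toLp 2 fun s => (v s : ℂ)
  map_add' v w := by ext s; simp
  map_smul' c v := by ext s; simp

lemma norm_complexify {κ : Type*} [Fintype κ] (v : EuclideanSpace ℝ κ) :
    ‖complexify κ v‖ = ‖v‖ := by
  simp [complexify, EuclideanSpace.norm_eq]

lemma ofReal_mulVec {ι κ : Type*} [Fintype κ] (M : Matrix ι κ ℝ) (v : κ → ℝ) :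
    (M.map Complex.ofReal) *ᵥ (fun s => (v s : ℂ)) = fun s => ((M *ᵥ v) s : ℂ) := by
  ext s
  simp [Matrix.mulVec, dotProduct]

lemma IsHurwitz.exists_decaysAt {κ : Type*} [Fintype κ] [DecidableEq κ] {M : Matrix κ κ ℝ}
    (hM : IsHurwitz M) : ∃ l : ℝ, 0 < l ∧ ∃ C : ℝ, 0 ≤ C ∧ DecaysAt M l C := by
  set Mc : Matrix κ κ ℂ := M.map Complex.ofReal with hMc
  set s := Mc.charpoly.roots with hs
  have hneg : ∀ μ ∈ s, μ.re < 0 := fun μ hμ =>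
    hM μ (Matrix.mem_spectrum_of_isRoot_charpoly (Polynomial.isRoot_of_mem_roots hμ))
  obtain ⟨e, he, hle⟩ := exists_pos_forall_le (ι := s.toFinset) (fun _ => True) (fun μ => -μ.1.re)
    (fun μ _ => by
      have := hneg μ.1 (Multiset.mem_toFinset.1 μ.2)
      linarith)
  have hre : ∀ μ ∈ s, μ.re < -(e / 2) := fun μ hμ => by
    have := hle ⟨μ, Multiset.mem_toFinset.2 hμ⟩ trivial
    simp only at this
    linarith
  obtain ⟨C, hC, h⟩ := exists_decay_of_annihilated (Matrix.toEuclideanCLM (n := κ) (𝕜 := ℂ) Mc)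
    (e / 2) s hre
  refine ⟨e / 2, by positivity, C, hC, fun y hy hy' t ht => ?_⟩
  have hprod : (s.map fun μ => Polynomial.X - Polynomial.C μ).prod = Mc.charpoly :=
    (IsAlgClosed.splits _).eq_prod_roots_of_monic (Matrix.charpoly_monic _) |>.symm
  have := h (fun t => complexify κ (y t)) (continuousOn_linearMap_comp _ hy)
    (fun t ht => by
      refine (hasDerivWithinAt_linearMap_comp (complexify κ) (hy' t ht)).congr_deriv ?_
      have := ofReal_mulVec M (y t).ofLp
      simp only [complexify, LinearMap.coe_mk, AddHom.coe_mk, Matrix.toEuclideanCLM_toLp]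
      rw [hMc, this]
      rfl)
    (fun t _ => by
      rw [hprod]
      have h1 : Polynomial.aeval (Matrix.toEuclideanCLM (n := κ) (𝕜 := ℂ) Mc) Mc.charpoly
          = Matrix.toEuclideanCLM (n := κ) (𝕜 := ℂ) (Polynomial.aeval Mc Mc.charpoly) :=
        Polynomial.aeval_algHom_apply
          ((Matrix.toEuclideanCLM (n := κ) (𝕜 := ℂ)).toAlgEquiv.toAlgHom) Mc _
      rw [h1, Matrix.aeval_self_charpoly, map_zero, zero_apply]) t ht
  simpa [norm_complexify] using this

/-! ### The undetectable subspace and its orthogonal complement -/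

lemma toEuclideanLin_mul {k l m : Type*} [Fintype l] [DecidableEq l] [Fintype m] [DecidableEq m]
    (M : Matrix k l ℝ) (M' : Matrix l m ℝ) (v : EuclideanSpace ℝ m) :
    Matrix.toEuclideanLin (M * M') v = Matrix.toEuclideanLin M (Matrix.toEuclideanLin M' v) := by
  simp

lemma inner_toEuclideanLin {k l : Type*} [Fintype k] [DecidableEq k] [Fintype l] [DecidableEq l]
    (M : Matrix k l ℝ) (v : EuclideanSpace ℝ l) (w : EuclideanSpace ℝ k) :
    inner ℝ (Matrix.toEuclideanLin M v) w = inner ℝ v (Matrix.toEuclideanLin Mᵀ w) := by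
  simp only [EuclideanSpace.inner_eq_star_dotProduct, Matrix.toLpLin_apply, star_trivial]
  rw [Matrix.dotProduct_mulVec, Matrix.mulVec_transpose]

lemma toEuclideanLin_one {k : Type*} [Fintype k] [DecidableEq k] (v : EuclideanSpace ℝ k) :
    Matrix.toEuclideanLin (1 : Matrix k k ℝ) v = v := by
  simp

section Undetectable

variable {n : ℕ} {r : Type*} {A : Matrix (Fin n) (Fin n) ℝ} {H : Matrix r (Fin n) ℝ}

/-- By the Cayley–Hamilton theorem, `H Aᵏ v = 0` for all `k < n` implies it for all `k`. -/
lemma mulVec_pow_eq_zero {v : Fin n → ℝ} (h : ∀ k < n, (H * A ^ k) *ᵥ v = 0) (k : ℕ) :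
    (H * A ^ k) *ᵥ v = 0 := by
  rcases Nat.eq_zero_or_pos n with rfl | hn
  · rw [Subsingleton.elim v 0, Matrix.mulVec_zero]
  have : NeZero n := ⟨hn.ne'⟩
  rw [Matrix.pow_eq_aeval_mod_charpoly]
  set p := (Polynomial.X ^ k : ℝ[X]) %ₘ A.charpoly with hp
  have hdeg : p.natDegree < n := by
    have := Polynomial.natDegree_modByMonic_lt (Polynomial.X ^ k : ℝ[X])
      (Matrix.charpoly_monic A) (fun h1 => by
        have := congrArg Polynomial.natDegree h1
        rw [Matrix.charpoly_natDegree_eq_dim, Polynomial.natDegree_one, Fintype.card_fin] at this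
        omega)
    rwa [Matrix.charpoly_natDegree_eq_dim, Fintype.card_fin] at this
  rw [Polynomial.aeval_eq_sum_range' hdeg, Matrix.mul_sum, Matrix.sum_mulVec]
  refine Finset.sum_eq_zero fun j hj => ?_
  rw [Matrix.mul_smul, Matrix.smul_mulVec, h j (Finset.mem_range.1 hj), smul_zero]

lemma toEuclideanLin_mem_undetectableSubspace {v : EuclideanSpace ℝ (Fin n)}
    (hv : v ∈ undetectableSubspace A H) :
    Matrix.toEuclideanLin A v ∈ undetectableSubspace A H := by
  refine ⟨fun k _ => ?_, ?_⟩
  · have := mulVec_pow_eq_zero hv.1 (k + 1)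
    rwa [pow_succ, ← Matrix.mul_assoc, ← Matrix.mulVec_mulVec] at this
  · have h1 : (fun s => ((Matrix.toEuclideanLin A v s : ℝ) : ℂ))
        = A.map Complex.ofReal *ᵥ fun s => (v s : ℂ) := (ofReal_mulVec A v.ofLp).symm
    set B := A.map Complex.ofReal with hB
    have h2 : Polynomial.aeval B (unstableFactor A) * B
        = B * Polynomial.aeval B (unstableFactor A) := by
      have := congrArg (Polynomial.aeval B) (mul_comm (unstableFactor A) Polynomial.X)
      simpa only [map_mul, Polynomial.aeval_X] using this
    rw [h1, Matrix.mulVec_mulVec, h2, ← Matrix.mulVec_mulVec, hv.2, Matrix.mulVec_zero]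

lemma toEuclideanLin_eq_zero_of_mem_undetectableSubspace {v : EuclideanSpace ℝ (Fin n)}
    (hv : v ∈ undetectableSubspace A H) : Matrix.toEuclideanLin H v = 0 := by
  have := mulVec_pow_eq_zero hv.1 0
  rw [pow_zero, Matrix.mul_one] at this
  rw [Matrix.toLpLin_apply, this, WithLp.toLp_zero]

/-- A vector that no agent can detect cannot be detected from the stacked measurements. -/
lemma mem_undetectableSubspace_stack {N : ℕ} [NeZero N] {m : Fin N → ℕ}
    {H : ∀ i, Matrix (Fin (m i)) (Fin n) ℝ} {v : EuclideanSpace ℝ (Fin n)}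
    (hv : ∀ i, v ∈ undetectableSubspace A (H i)) : v ∈ undetectableSubspace A (stack H) := by
  refine ⟨fun k hk => ?_, (hv 0).2⟩
  ext ⟨i, s⟩
  exact congrFun ((hv i).1 k hk) s

end Undetectable

section OrthonormalBasis

variable {n : ℕ} {κ : Type*} {B : Matrix (Fin n) κ ℝ}
  {W : Submodule ℝ (EuclideanSpace ℝ (Fin n))}

lemma toEuclideanLin_transpose_apply (B : Matrix (Fin n) κ ℝ) (v : EuclideanSpace ℝ (Fin n))
    (k : κ) : Matrix.toEuclideanLin Bᵀ v k = inner ℝ (WithLp.toLp 2 (B.col k)) v := by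
  simp [Matrix.toLpLin_apply, Matrix.mulVec, dotProduct, PiLp.inner_apply, mul_comm]

lemma IsOrthonormalBasisOf.transpose_eq_zero (h : IsOrthonormalBasisOf B W)
    {v : EuclideanSpace ℝ (Fin n)} (hv : v ∈ Wᗮ) : Matrix.toEuclideanLin Bᵀ v = 0 := by
  ext k
  rw [toEuclideanLin_transpose_apply]
  exact hv _ (h.2 ▸ Submodule.subset_span (Set.mem_range_self k))

variable [Fintype κ] [DecidableEq κ]

lemma toEuclideanLin_eq_sum (B : Matrix (Fin n) κ ℝ) (y : EuclideanSpace ℝ κ) :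
    Matrix.toEuclideanLin B y = ∑ k, y k • WithLp.toLp 2 (B.col k) := by
  ext s
  simp [Matrix.toLpLin_apply, Matrix.mulVec, dotProduct, mul_comm]

lemma IsOrthonormalBasisOf.mem (h : IsOrthonormalBasisOf B W) (y : EuclideanSpace ℝ κ) :
    Matrix.toEuclideanLin B y ∈ W := by
  rw [toEuclideanLin_eq_sum, ← h.2]
  exact Submodule.sum_mem _ fun k _ =>
    Submodule.smul_mem _ _ (Submodule.subset_span (Set.mem_range_self k))

lemma IsOrthonormalBasisOf.transpose_apply (h : IsOrthonormalBasisOf B W)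
    (y : EuclideanSpace ℝ κ) :
    Matrix.toEuclideanLin Bᵀ (Matrix.toEuclideanLin B y) = y := by
  ext k
  rw [toEuclideanLin_transpose_apply, toEuclideanLin_eq_sum, h.1.inner_right_fintype]

lemma IsOrthonormalBasisOf.norm_apply (h : IsOrthonormalBasisOf B W) (y : EuclideanSpace ℝ κ) :
    ‖Matrix.toEuclideanLin B y‖ = ‖y‖ := by
  have : inner ℝ (Matrix.toEuclideanLin B y) (Matrix.toEuclideanLin B y) = inner ℝ y y := by
    rw [inner_toEuclideanLin, h.transpose_apply]
  rw [real_inner_self_eq_norm_sq, real_inner_self_eq_norm_sq] at this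
  exact (sq_eq_sq₀ (norm_nonneg _) (norm_nonneg _)).1 this

/-- `B Bᵀ` is the orthogonal projection onto the span of the columns of `B`. -/
lemma IsOrthonormalBasisOf.apply_transpose (h : IsOrthonormalBasisOf B W)
    (v : EuclideanSpace ℝ (Fin n)) :
    Matrix.toEuclideanLin B (Matrix.toEuclideanLin Bᵀ v) = W.starProjection v := by
  symm
  refine Submodule.eq_starProjection_of_mem_of_inner_eq_zero (h.mem _) fun w hw => ?_
  rw [← h.2] at hw
  induction hw using Submodule.span_induction with
  | mem x hx =>
    obtain ⟨k, rfl⟩ := hx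
    rw [real_inner_comm, ← toEuclideanLin_transpose_apply, map_sub, h.transpose_apply, sub_self]
    rfl
  | zero => simp
  | add x y _ _ hx hy => rw [inner_add_right, hx, hy, add_zero]
  | smul c x _ hx => rw [inner_smul_right, hx, mul_zero]

end OrthonormalBasis

/-! ### The coupling gain -/

lemma lambdaMin_mul_dotProduct_le {κ : Type*} [Fintype κ] [DecidableEq κ] {M : Matrix κ κ ℝ}
    (hM : M.IsHermitian) (y : κ → ℝ) : lambdaMin M * (y ⬝ᵥ y) ≤ y ⬝ᵥ M *ᵥ y := by
  have hfin : (spectrum ℝ M).Finite := by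
    rw [hM.spectrum_real_eq_range_eigenvalues]; exact Set.finite_range _
  have hps : (M - algebraMap ℝ (Matrix κ κ ℝ) (lambdaMin M)).PosSemidef := by
    rw [Matrix.posSemidef_iff_isHermitian_and_spectrum_nonneg]
    refine ⟨hM.sub (by
      rw [Matrix.IsHermitian, Matrix.algebraMap_eq_diagonal, Matrix.diagonal_conjTranspose]
      rfl), fun z hz => ?_⟩
    rw [← spectrum.sub_singleton_eq] at hz
    obtain ⟨w, hw, r, rfl, rfl⟩ := Set.mem_sub.1 hz
    exact sub_nonneg.2 (csInf_le hfin.bddBelow hw)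
  have := hps.dotProduct_mulVec_nonneg y
  rw [Matrix.sub_mulVec, dotProduct_sub, Algebra.algebraMap_eq_smul_one, Matrix.smul_mulVec,
    Matrix.one_mulVec, dotProduct_smul, star_trivial, smul_eq_mul] at this
  linarith

lemma lambdaMin_pos {κ : Type*} [Fintype κ] [DecidableEq κ] [Nonempty κ] {M : Matrix κ κ ℝ}
    (hM : M.PosDef) : 0 < lambdaMin M := by
  have h : lambdaMin M ∈ spectrum ℝ M := by
    rw [lambdaMin, hM.1.spectrum_real_eq_range_eigenvalues]
    exact (Set.range_nonempty _).csInf_mem (Set.finite_range _)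
  rw [hM.1.spectrum_real_eq_range_eigenvalues] at h
  obtain ⟨k, hk⟩ := h
  rw [← hk]
  exact hM.eigenvalues_pos k

section Laplacian

variable {N n : ℕ} {G : SimpleGraph (Fin N)} [DecidableRel G.Adj] {a : Matrix (Fin N) (Fin N) ℝ}

lemma IsAdjacencyMatrix.nonneg (ha : IsAdjacencyMatrix G a) (i j : Fin N) : 0 ≤ a i j := by
  by_cases h : G.Adj i j
  · exact (ha.pos i j h).le
  · exact (ha.zero i j h).ge

/-- Sums over the neighbours are sums over all agents, since the other weights vanish. -/
lemma IsAdjacencyMatrix.sum_neighborFinset (ha : IsAdjacencyMatrix G a) {M : Type*}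
    [AddCommMonoid M] [Module ℝ M] (i : Fin N) (f : Fin N → M) :
    ∑ j ∈ G.neighborFinset i, a i j • f j = ∑ j, a i j • f j := by
  refine Finset.sum_subset (Finset.subset_univ _) fun j _ hj => ?_
  rw [ha.zero i j (by simpa using hj), zero_smul]

lemma laplacian_mulVec (ha : IsAdjacencyMatrix G a) (z : Fin N → ℝ) (i : Fin N) :
    (laplacian G a *ᵥ z) i = ∑ j, a i j * (z i - z j) := by
  have hd : ∑ k ∈ G.neighborFinset i, a i k = ∑ k, a i k := by
    simpa using ha.sum_neighborFinset i (fun _ => (1 : ℝ))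
  have h : ∀ j, laplacian G a i j * z j
      = (if i = j then (∑ k, a i k) * z i else 0) - a i j * z j := by
    intro j
    by_cases hij : i = j
    · subst hij
      simp [laplacian, hd, ha.zero i i (G.irrefl)]
    · simp [laplacian, hij]
  simp only [Matrix.mulVec, dotProduct, h, Finset.sum_sub_distrib, mul_sub]
  simp [Finset.sum_mul]

/-- Summation by parts over the edges of an undirected weighted graph. -/
lemma sum_inner_sum_smul {ι E : Type*} [Fintype ι] [NormedAddCommGroup E] [InnerProductSpace ℝ E]
    {a : Matrix ι ι ℝ} (hs : ∀ i j, a i j = a j i) (q : ι → E) {e : ι → ι → E}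
    (he : ∀ i j, e i j = -e j i) :
    ∑ i, inner ℝ (q i) (∑ j, a i j • e i j)
      = 1 / 2 * ∑ i, ∑ j, a i j * inner ℝ (q i - q j) (e i j) := by
  have h : ∑ i, ∑ j, a i j * inner ℝ (q j) (e i j) = -∑ i, ∑ j, a i j * inner ℝ (q i) (e i j) := by
    rw [Finset.sum_comm]
    simp only [← Finset.sum_neg_distrib]
    refine Finset.sum_congr rfl fun i _ => Finset.sum_congr rfl fun j _ => ?_
    rw [hs j i, he j i, inner_neg_right, mul_neg]
  simp only [inner_sum, inner_smul_right, inner_sub_left, mul_sub, Finset.sum_sub_distrib, h]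
  ring

end Laplacian

section Gain

variable {N n : ℕ} {G : SimpleGraph (Fin N)} [DecidableRel G.Adj] {a : Matrix (Fin N) (Fin N) ℝ}
  {p : Fin N → ℕ}

lemma blockU_mulVec (U : ∀ i, Matrix (Fin n) (Fin (p i)) ℝ) (y : ((i : Fin N) × Fin (p i)) → ℝ)
    (r : Fin N × Fin n) :
    (blockU U *ᵥ y) r = (U r.1 *ᵥ fun k => y ⟨r.1, k⟩) r.2 := by
  simp only [Matrix.mulVec, dotProduct, blockU, Matrix.of_apply, Fintype.sum_sigma, ite_mul,
    zero_mul]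
  rw [Finset.sum_eq_single r.1 (fun i _ hi => by simp [hi.symm]) (by simp)]
  simp

lemma kronecker_one_mulVec (K : Matrix (Fin N) (Fin N) ℝ) (z : Fin N × Fin n → ℝ)
    (r : Fin N × Fin n) :
    ((K ⊗ₖ (1 : Matrix (Fin n) (Fin n) ℝ)) *ᵥ z) r = (K *ᵥ fun j => z (j, r.2)) r.1 := by
  simp [Matrix.mulVec, dotProduct, Fintype.sum_prod_type, Matrix.one_apply]

/-- The disagreement energy `½ ∑ a_{ij} ‖zᵢ - zⱼ‖²`. -/
noncomputable def energy {E : Type*} [NormedAddCommGroup E] (a : Matrix (Fin N) (Fin N) ℝ) (z : Fin N → E) : ℝ :=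
  1 / 2 * ∑ i, ∑ j, a i j * ‖z i - z j‖ ^ 2

lemma energy_nonneg {E : Type*} [NormedAddCommGroup E] (ha : IsAdjacencyMatrix G a)
    (z : Fin N → E) : 0 ≤ energy a z :=
  mul_nonneg (by norm_num) (Finset.sum_nonneg fun i _ => Finset.sum_nonneg fun j _ =>
    mul_nonneg (ha.nonneg i j) (sq_nonneg _))

/-- On a connected graph only the constant families have zero disagreement energy. -/
lemma eq_of_energy_eq_zero {E : Type*} [NormedAddCommGroup E] (ha : IsAdjacencyMatrix G a)
    (hG : G.Connected) {z : Fin N → E} (h : energy a z = 0) (i j : Fin N) : z i = z j := by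
  have hnn : ∀ i j, 0 ≤ a i j * ‖z i - z j‖ ^ 2 := fun i j =>
    mul_nonneg (ha.nonneg i j) (sq_nonneg _)
  have h0 : ∑ i, ∑ j, a i j * ‖z i - z j‖ ^ 2 = 0 := by
    unfold energy at h; linarith
  rw [Finset.sum_eq_zero_iff_of_nonneg fun i _ => Finset.sum_nonneg fun j _ => hnn i j] at h0
  have hadj : ∀ i j, G.Adj i j → z i = z j := fun i j hij => by
    have h1 := h0 i (Finset.mem_univ i)
    rw [Finset.sum_eq_zero_iff_of_nonneg fun j _ => hnn i j] at h1
    have h2 := h1 j (Finset.mem_univ j)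
    simpa [(ha.pos i j hij).ne', sub_eq_zero] using h2
  obtain ⟨w⟩ := hG.preconnected i j
  induction w with
  | nil => rfl
  | cons hij _ ih => exact (hadj _ _ hij).trans ih

lemma dotProduct_laplacian_mulVec (ha : IsAdjacencyMatrix G a)
    (U : ∀ i, Matrix (Fin n) (Fin (p i)) ℝ) (y : ∀ i, EuclideanSpace ℝ (Fin (p i))) :
    (fun q : (i : Fin N) × Fin (p i) => y q.1 q.2) ⬝ᵥ ((blockU U)ᵀ *
      (laplacian G a ⊗ₖ (1 : Matrix (Fin n) (Fin n) ℝ)) * blockU U) *ᵥ (fun q => y q.1 q.2)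
      = energy a fun i => Matrix.toEuclideanLin (U i) (y i) := by
  have h := sum_inner_sum_smul ha.symm (fun i => Matrix.toEuclideanLin (U i) (y i))
    (e := fun i j => Matrix.toEuclideanLin (U i) (y i) - Matrix.toEuclideanLin (U j) (y j))
    (fun i j => (neg_sub _ _).symm)
  simp only [real_inner_self_eq_norm_sq] at h
  rw [energy, ← h, ← Matrix.mulVec_mulVec, ← Matrix.mulVec_mulVec, Matrix.dotProduct_mulVec,
    Matrix.vecMul_transpose]
  simp only [dotProduct, Fintype.sum_prod_type, blockU_mulVec, kronecker_one_mulVec,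
    laplacian_mulVec ha]
  refine Finset.sum_congr rfl fun i _ => ?_
  simp [PiLp.inner_apply, Matrix.toLpLin_apply, mul_comm]

lemma dotProduct_sigma (y : ∀ i, EuclideanSpace ℝ (Fin (p i))) :
    (fun q : (i : Fin N) × Fin (p i) => y q.1 q.2) ⬝ᵥ (fun q => y q.1 q.2) = ∑ i, ‖y i‖ ^ 2 := by
  simp [dotProduct, Fintype.sum_sigma, EuclideanSpace.norm_sq_eq, ← sq]

/-- The symmetric part of `A_u` is bounded by its spectral norm. -/
lemma sum_inner_le_specNorm (A : Matrix (Fin n) (Fin n) ℝ) (U : ∀ i, Matrix (Fin n) (Fin (p i)) ℝ)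
    (y : ∀ i, EuclideanSpace ℝ (Fin (p i))) :
    ∑ i, 2 * inner ℝ (Matrix.toEuclideanLin (U i) (y i))
        (Matrix.toEuclideanLin A (Matrix.toEuclideanLin (U i) (y i)))
      ≤ specNorm (blockAu A U + (blockAu A U)ᵀ) * ∑ i, ‖y i‖ ^ 2 := by
  set Y : EuclideanSpace ℝ ((i : Fin N) × Fin (p i)) := WithLp.toLp 2 fun q => y q.1 q.2 with hY
  set S := blockAu A U + (blockAu A U)ᵀ with hS
  have hnorm : ‖Y‖ ^ 2 = ∑ i, ‖y i‖ ^ 2 := by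
    simp [hY, EuclideanSpace.norm_sq_eq, Fintype.sum_sigma]
  have hblock : ∀ i k, (blockAu A U *ᵥ fun q => y q.1 q.2) ⟨i, k⟩
      = (((U i)ᵀ * A * U i) *ᵥ (y i).ofLp) k := by
    intro i k
    simp only [blockAu, Matrix.mulVec, dotProduct, Matrix.blockDiagonal'_apply, Fintype.sum_sigma]
    rw [Finset.sum_eq_single i (fun j _ hj => by simp [hj.symm]) (by simp)]
    simp
  have hinner : inner ℝ Y (Matrix.toEuclideanCLM (n := _) (𝕜 := ℝ) S Y)
      = ∑ i, 2 * inner ℝ (Matrix.toEuclideanLin (U i) (y i))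
        (Matrix.toEuclideanLin A (Matrix.toEuclideanLin (U i) (y i))) := by
    have h1 : inner ℝ Y (Matrix.toEuclideanCLM (n := _) (𝕜 := ℝ) S Y)
        = 2 * ((fun q : (i : Fin N) × Fin (p i) => y q.1 q.2) ⬝ᵥ
          (blockAu A U *ᵥ fun q => y q.1 q.2)) := by
      rw [hY, Matrix.toEuclideanCLM_toLp, EuclideanSpace.inner_eq_star_dotProduct, star_trivial,
        hS, Matrix.add_mulVec, add_dotProduct, Matrix.mulVec_transpose, ← Matrix.dotProduct_mulVec,
        dotProduct_comm, two_mul]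
    rw [h1, dotProduct, Fintype.sum_sigma, Finset.mul_sum]
    refine Finset.sum_congr rfl fun i _ => ?_
    simp only [hblock]
    rw [inner_toEuclideanLin, ← toEuclideanLin_mul, ← toEuclideanLin_mul]
    simp [PiLp.inner_apply, Matrix.toLpLin_apply, mul_comm, Matrix.mul_assoc]
  rw [← hinner, ← hnorm, specNorm]
  calc _ ≤ ‖Y‖ * ‖Matrix.toEuclideanCLM (n := _) (𝕜 := ℝ) S Y‖ := real_inner_le_norm _ _
    _ ≤ ‖Y‖ * (‖Matrix.toEuclideanCLM (n := _) (𝕜 := ℝ) S‖ * ‖Y‖) := by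
      gcongr; exact ContinuousLinearMap.le_opNorm _ _
    _ = _ := by ring

variable {m : Fin N → ℕ} {A : Matrix (Fin n) (Fin n) ℝ} {H : ∀ i, Matrix (Fin (m i)) (Fin n) ℝ}

lemma isHermitian_reduced_laplacian (ha : IsAdjacencyMatrix G a)
    (U : ∀ i, Matrix (Fin n) (Fin (p i)) ℝ) :
    ((blockU U)ᵀ * (laplacian G a ⊗ₖ (1 : Matrix (Fin n) (Fin n) ℝ)) * blockU U).IsHermitian := by
  have hl : (laplacian G a)ᵀ = laplacian G a := by
    ext i j
    by_cases h : i = j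
    · subst h; rfl
    · simp [laplacian, h, Ne.symm h, ha.symm i j]
  rw [Matrix.IsHermitian, Matrix.conjTranspose_eq_transpose_of_trivial, Matrix.transpose_mul,
    Matrix.transpose_mul, Matrix.transpose_transpose, ← Matrix.kroneckerMap_transpose, hl,
    Matrix.transpose_one, Matrix.mul_assoc]

/-- Joint detectability and connectedness make the reduced Laplacian `Uᵀ (𝓛 ⊗ I) U` positive
definite: a family of zero disagreement energy is constant, and its value is undetectable for
every agent. -/
lemma posDef_reduced_laplacian (ha : IsAdjacencyMatrix G a) (hG : G.Connected)
    (hdet : IsDetectable A (stack H)) {U : ∀ i, Matrix (Fin n) (Fin (p i)) ℝ}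
    (hU : ∀ i, IsOrthonormalBasisOf (U i) (undetectableSubspace A (H i))) :
    ((blockU U)ᵀ * (laplacian G a ⊗ₖ (1 : Matrix (Fin n) (Fin n) ℝ)) * blockU U).PosDef := by
  refine Matrix.PosDef.of_dotProduct_mulVec_pos (isHermitian_reduced_laplacian ha U) fun x hx => ?_
  set y : ∀ i, EuclideanSpace ℝ (Fin (p i)) := fun i => WithLp.toLp 2 fun k => x ⟨i, k⟩ with hy
  have hE := dotProduct_laplacian_mulVec ha U y
  have hxy : (fun q : (i : Fin N) × Fin (p i) => y q.1 q.2) = x := rfl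
  rw [hxy] at hE
  rw [star_trivial, hE]
  refine lt_of_le_of_ne (energy_nonneg ha _) fun h0 => hx ?_
  have hc := eq_of_energy_eq_zero ha hG h0.symm
  have : NeZero N := ⟨by rintro rfl; exact hG.nonempty.elim fun i => i.elim0⟩
  have hz : Matrix.toEuclideanLin (U 0) (y 0) = 0 := by
    have hmem : Matrix.toEuclideanLin (U 0) (y 0) ∈ undetectableSubspace A (stack H) :=
      mem_undetectableSubspace_stack fun i => by rw [hc 0 i]; exact (hU i).mem _
    rw [hdet] at hmem
    exact (Submodule.mem_bot ℝ).1 hmem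
  funext ⟨i, k⟩
  have hyi : y i = 0 := by
    rw [← norm_eq_zero, ← (hU i).norm_apply, hc i 0, hz, norm_zero]
  have : y i k = 0 := by rw [hyi]; rfl
  exact this

/-- The lower bound on the coupling gain in terms of energies. If all undetectable subspaces
vanish, the smallest eigenvalue is `sInf ∅ = 0` and the bound on the gain only says `0 ≤ c`, but
then the left-hand side vanishes as well. -/
lemma coupling_gain (ha : IsAdjacencyMatrix G a) (hG : G.Connected)
    (hdet : IsDetectable A (stack H)) {U : ∀ i, Matrix (Fin n) (Fin (p i)) ℝ}
    (hU : ∀ i, IsOrthonormalBasisOf (U i) (undetectableSubspace A (H i)))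
    {eps c : ℝ} (heps : 0 < eps) (heps' : eps < 1 / 2)
    (hc : (2 + specNorm (blockAu A U + (blockAu A U)ᵀ)) /
      ((1 - 2 * eps) * lambdaMin ((blockU U)ᵀ *
        (laplacian G a ⊗ₖ (1 : Matrix (Fin n) (Fin n) ℝ)) * blockU U)) ≤ c) :
    0 ≤ c ∧ ∀ y : ∀ i, EuclideanSpace ℝ (Fin (p i)),
      2 * ∑ i, ‖y i‖ ^ 2 + ∑ i, 2 * inner ℝ (Matrix.toEuclideanLin (U i) (y i))
        (Matrix.toEuclideanLin A (Matrix.toEuclideanLin (U i) (y i)))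
      ≤ c * energy a fun i => Matrix.toEuclideanLin (U i) (y i) := by
  set K := (blockU U)ᵀ * (laplacian G a ⊗ₖ (1 : Matrix (Fin n) (Fin n) ℝ)) * blockU U with hK
  have hS : 0 ≤ specNorm (blockAu A U + (blockAu A U)ᵀ) := norm_nonneg _
  set S := specNorm (blockAu A U + (blockAu A U)ᵀ) with hSdef
  rcases isEmpty_or_nonempty ((i : Fin N) × Fin (p i)) with hemp | hne
  · have hl : lambdaMin K = 0 := by
      rw [lambdaMin, spectrum.of_subsingleton, Real.sInf_empty]
    rw [hl, mul_zero, div_zero] at hc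
    refine ⟨hc, fun y => ?_⟩
    have hy : ∀ i, y i = 0 := fun i => by
      ext k; exact (hemp.false ⟨i, k⟩).elim
    have := energy_nonneg ha fun i => Matrix.toEuclideanLin (U i) (y i)
    simp only [hy, map_zero, norm_zero, inner_zero_right] at this ⊢
    simpa using mul_nonneg hc this
  · have hpd : K.PosDef := posDef_reduced_laplacian ha hG hdet hU
    have hl := lambdaMin_pos hpd
    have he : 0 < 1 - 2 * eps := by linarith
    have hc0 : 0 ≤ c := le_trans (by positivity) hc
    refine ⟨hc0, fun y => ?_⟩
    have h1 := lambdaMin_mul_dotProduct_le hpd.1 fun q => y q.1 q.2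
    rw [dotProduct_sigma, hK, dotProduct_laplacian_mulVec ha U y, ← hK] at h1
    have h2 := sum_inner_le_specNorm A U y
    rw [← hSdef] at h2
    rw [div_le_iff₀ (by positivity)] at hc
    have hV : 0 ≤ ∑ i, ‖y i‖ ^ 2 := Finset.sum_nonneg fun i _ => sq_nonneg _
    have h3 : 2 + S ≤ c * lambdaMin K := by
      have : c * ((1 - 2 * eps) * lambdaMin K) ≤ c * (1 * lambdaMin K) := by
        gcongr; linarith
      linarith
    have h4 := mul_le_mul_of_nonneg_right h3 hV
    have h5 := mul_le_mul_of_nonneg_left h1 hc0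
    linarith

end Gain

/-! ### The splitting of the agents' coordinates -/

section Split

variable {N n : ℕ} {m : Fin N → ℕ} {A : Matrix (Fin n) (Fin n) ℝ}
  {H : ∀ i, Matrix (Fin (m i)) (Fin n) ℝ} {G : SimpleGraph (Fin N)} [DecidableRel G.Adj]
  {a : Matrix (Fin N) (Fin N) ℝ}

/-- The coordinates `Dᵢᵀ v` of the component of `v` orthogonal to the undetectable subspace. -/
noncomputable abbrev Design.detPart (d : Design A H G a) (i : Fin N) :
    EuclideanSpace ℝ (Fin n) →ₗ[ℝ] EuclideanSpace ℝ (Fin (n - undetDim A (H i))) :=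
  Matrix.toEuclideanLin (d.D i)ᵀ

/-- The coordinates `Uᵢᵀ v` of the undetectable component of `v`. -/
noncomputable abbrev Design.undetPart (d : Design A H G a) (i : Fin N) :
    EuclideanSpace ℝ (Fin n) →ₗ[ℝ] EuclideanSpace ℝ (Fin (undetDim A (H i))) :=
  Matrix.toEuclideanLin (d.U i)ᵀ

variable (d : Design A H G a) (i : Fin N)

lemma Design.add_eq (v : EuclideanSpace ℝ (Fin n)) :
    Matrix.toEuclideanLin (d.U i) (d.undetPart i v) + Matrix.toEuclideanLin (d.D i) (d.detPart i v)
      = v := by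
  rw [(d.U_basis i).apply_transpose, (d.D_basis i).apply_transpose,
    Submodule.starProjection_add_starProjection_orthogonal]

lemma Design.detPart_U (y : EuclideanSpace ℝ (Fin (undetDim A (H i)))) :
    d.detPart i (Matrix.toEuclideanLin (d.U i) y) = 0 :=
  (d.D_basis i).transpose_eq_zero (Submodule.le_orthogonal_orthogonal _ ((d.U_basis i).mem y))

lemma Design.undetPart_D (y : EuclideanSpace ℝ (Fin (n - undetDim A (H i)))) :
    d.undetPart i (Matrix.toEuclideanLin (d.D i) y) = 0 :=
  (d.U_basis i).transpose_eq_zero ((d.D_basis i).mem y)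

lemma Design.norm_detPart_le (v : EuclideanSpace ℝ (Fin n)) : ‖d.detPart i v‖ ≤ ‖v‖ := by
  rw [← (d.D_basis i).norm_apply, (d.D_basis i).apply_transpose]
  exact Submodule.norm_starProjection_apply_le _ _

lemma Design.norm_undetPart_le (v : EuclideanSpace ℝ (Fin n)) : ‖d.undetPart i v‖ ≤ ‖v‖ := by
  rw [← (d.U_basis i).norm_apply, (d.U_basis i).apply_transpose]
  exact Submodule.norm_starProjection_apply_le _ _

lemma Design.norm_sq_add (y : EuclideanSpace ℝ (Fin (undetDim A (H i))))
    (w : EuclideanSpace ℝ (Fin (n - undetDim A (H i)))) :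
    ‖Matrix.toEuclideanLin (d.U i) y + Matrix.toEuclideanLin (d.D i) w‖ ^ 2
      = ‖y‖ ^ 2 + ‖w‖ ^ 2 := by
  rw [norm_add_sq_real, inner_toEuclideanLin, d.undetPart_D, inner_zero_right,
    (d.U_basis i).norm_apply, (d.D_basis i).norm_apply]
  ring

/-- The undetectable subspace is invariant, so the component orthogonal to it evolves on its
own. -/
lemma Design.detPart_A (v : EuclideanSpace ℝ (Fin n)) :
    d.detPart i (Matrix.toEuclideanLin A v)
      = Matrix.toEuclideanLin ((d.D i)ᵀ * A * d.D i) (d.detPart i v) := by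
  have h : d.detPart i (Matrix.toEuclideanLin A
      (Matrix.toEuclideanLin (d.U i) (d.undetPart i v))) = 0 :=
    (d.D_basis i).transpose_eq_zero (Submodule.le_orthogonal_orthogonal _
      (toEuclideanLin_mem_undetectableSubspace ((d.U_basis i).mem _)))
  conv_lhs => rw [← d.add_eq i v, map_add, map_add, h, zero_add]
  rw [toEuclideanLin_mul, toEuclideanLin_mul]

lemma Design.H_apply (v : EuclideanSpace ℝ (Fin n)) :
    Matrix.toEuclideanLin (H i) v
      = Matrix.toEuclideanLin (H i * d.D i) (d.detPart i v) := by
  conv_lhs => rw [← d.add_eq i v, map_add,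
    toEuclideanLin_eq_zero_of_mem_undetectableSubspace ((d.U_basis i).mem _), zero_add]
  rw [toEuclideanLin_mul]

lemma Design.L_apply (z : EuclideanSpace ℝ (Fin (m i))) :
    Matrix.toEuclideanLin (d.L i) z
      = Matrix.toEuclideanLin (d.D i) (Matrix.toEuclideanLin (d.Ld i) z) := by
  rw [← toEuclideanLin_mul, Design.L, Design.T, Matrix.fromCols_mul_fromRows, Matrix.mul_zero,
    add_zero]

lemma Design.M_apply (z : EuclideanSpace ℝ (Fin n)) :
    Matrix.toEuclideanLin (d.M i) z = Matrix.toEuclideanLin (d.U i) (d.undetPart i z) := by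
  rw [← toEuclideanLin_mul, Design.M, Design.T, Matrix.fromCols_mul_fromBlocks,
    Matrix.transpose_fromCols, Matrix.fromCols_mul_fromRows]
  simp

end Split

/-! ### Positivity of the auxiliary variables -/

section ClosedLoop

variable {N n : ℕ} {m : Fin N → ℕ} {A : Matrix (Fin n) (Fin n) ℝ}
  {H : ∀ i, Matrix (Fin (m i)) (Fin n) ℝ} {G : SimpleGraph (Fin N)} [DecidableRel G.Adj]
  {a : Matrix (Fin N) (Fin N) ℝ} {d : Design A H G a} {S : Signals N n}

lemma disagreement_nonneg (ha : IsAdjacencyMatrix G a)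
    (z : Fin N → Fin N → EuclideanSpace ℝ (Fin n)) (i : Fin N) : 0 ≤ disagreement G a z i :=
  Finset.sum_nonneg fun k _ => mul_nonneg (ha.nonneg i k) (sq_nonneg _)

lemma Signals.held_self (S : Signals N n) (A : Matrix (Fin n) (Fin n) ℝ) (i j : Fin N) (k : ℕ) :
    S.held A i j k (S.ts i j k) = S.xhat i (S.ts i j k) := by
  rw [Signals.held, sub_self, zero_smul, NormedSpace.exp_zero, toEuclideanLin_one]

lemma IsClosedLoop.exists_mem_Ico (h : IsClosedLoop d S) {i j : Fin N} (hij : G.Adj i j) {t : ℝ}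
    (ht : 0 ≤ t) (hr : S.Reached G t) : ∃ k, t ∈ Set.Ico (S.ts i j k) (S.ts i j (k + 1)) := by
  classical
  have hex := hr i j hij
  have hpos : Nat.find hex ≠ 0 := fun h0 => by
    have := Nat.find_spec hex
    rw [h0, h.ts_zero i j hij] at this
    exact absurd ht (not_le.2 this)
  obtain ⟨k, hk⟩ := Nat.exists_eq_succ_of_ne_zero hpos
  refine ⟨k, not_lt.1 (Nat.find_min hex (m := k) (by omega)), ?_⟩
  have := Nat.find_spec hex
  rwa [hk] at this

lemma IsClosedLoop.ts_strictMono (h : IsClosedLoop d S) {i j : Fin N} (hij : G.Adj i j) :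
    StrictMono (S.ts i j) :=
  strictMono_nat_of_lt_succ (h.ts_lt i j hij)

lemma IsClosedLoop.ts_nonneg (h : IsClosedLoop d S) {i j : Fin N} (hij : G.Adj i j) (k : ℕ) :
    0 ≤ S.ts i j k := by
  rw [← h.ts_zero i j hij]
  exact (h.ts_strictMono hij).monotone (Nat.zero_le k)

/-- At sampling instants the sample error vanishes, and in between the trigger function is
nonpositive. -/
lemma IsClosedLoop.sampleError_le (h : IsClosedLoop d S) (ha : IsAdjacencyMatrix G a)
    {i j : Fin N} (hij : G.Adj i j) {t : ℝ} (ht : 0 ≤ t) (hr : S.Reached G t)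
    (hrho : 0 ≤ S.rho i j t) :
    d.sampleError (fun l q => S.xbar l q t) (S.xhat i t) i j
      ≤ d.beta / (G.degree i : ℝ) * disagreement G a (fun l q => S.xbar l q t) i
        + d.kappa i j * S.rho i j t := by
  obtain ⟨k, hk⟩ := h.exists_mem_Ico hij ht hr
  rcases eq_or_lt_of_le hk.1 with h0 | hlt
  · have h1 : S.xbar i j t = S.xhat i t := by
      rw [h.xbar_eq i j hij k t hk, ← h0, S.held_self]
    have h2 : d.sampleError (fun l q => S.xbar l q t) (S.xhat i t) i j = 0 := by
      simp [Design.sampleError, h1]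
    rw [h2]
    have := d.beta_pos
    have := d.kappa_pos i j hij
    have := disagreement_nonneg ha (fun l q => S.xbar l q t) i
    positivity
  · have := h.not_before i j hij k t ⟨hlt, hk.2⟩
    rw [not_or, not_lt, Design.trigger] at this
    linarith [this.1]

/-- As long as the solution is governed by its equations, `ρ̇ ≥ -(δ + κ) ρ` where `ρ > 0`, so `ρ`
stays above a decaying exponential. -/
lemma IsClosedLoop.rho_pos_of_reached (h : IsClosedLoop d S) (ha : IsAdjacencyMatrix G a)
    {i j : Fin N} (hij : G.Adj i j) {T : ℝ} (hT : 0 ≤ T)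
    (hr : ∀ t, 0 ≤ t → t < T → S.Reached G t) : 0 < S.rho i j T := by
  have h0 := h.rho_init i j hij
  set K : ℝ := d.delta i j + d.kappa i j + 1 with hK
  have hB : ∀ t : ℝ, HasDerivAt (fun t => -(S.rho i j 0 / 2) * Real.exp (-K * t))
      (-(S.rho i j 0 / 2) * (Real.exp (-K * t) * -K)) t := by
    intro t
    have h1 : HasDerivAt (fun t : ℝ => -K * t) (-K) t := by
      simpa using (hasDerivAt_id t).const_mul (-K)
    exact h1.exp.const_mul _
  have := image_le_of_deriv_right_lt_deriv_boundary
    (f := fun t => -S.rho i j t) (a := 0) (b := T)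
    ((h.rho_cont i j hij).mono Set.Icc_subset_Ici_self).neg
    (fun t ht => (h.rho_deriv i j hij t ht.1 (hr t ht.1 ht.2)).neg)
    (by simp; linarith) hB
    (by
      intro t ht heq
      have hexp := Real.exp_pos (-K * t)
      have hrho : S.rho i j t = S.rho i j 0 / 2 * Real.exp (-K * t) := by
        have : -S.rho i j t = -(S.rho i j 0 / 2) * Real.exp (-K * t) := heq
        linarith
      have hpos : 0 < S.rho i j t := by rw [hrho]; positivity
      have hle := h.sampleError_le ha hij ht.1 (hr t ht.1 ht.2) hpos.le
      have hg : 0 ≤ d.gamma i j * ‖Matrix.toEuclideanLin (H i) (S.xhat i t)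
          - Matrix.toEuclideanLin (H i) (S.x t)‖ ^ 2 :=
        mul_nonneg (d.gamma_pos i j hij).le (sq_nonneg _)
      have hrhs : -(S.rho i j 0 / 2) * (Real.exp (-K * t) * -K) = K * S.rho i j t := by
        rw [hrho]; ring
      rw [hrhs, hK]
      linarith)
    (Set.right_mem_Icc.2 hT)
  have hexp := Real.exp_pos (-K * T)
  have : 0 < S.rho i j 0 / 2 * Real.exp (-K * T) := by positivity
  linarith

/-! ### Absence of accumulations of sampling instants -/

section Exp

open scoped Matrix.Norms.L2Operator

/-- The operator norm on matrices serves only to make them a Banach algebra; its topology is the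
product topology that the exponential in `Signals.held` refers to. -/
lemma hasDerivAt_exp_smul_apply (A : Matrix (Fin n) (Fin n) ℝ) (s t : ℝ)
    (v : EuclideanSpace ℝ (Fin n)) :
    HasDerivAt (fun t => Matrix.toEuclideanLin (NormedSpace.exp ((t - s) • A)) v)
      (Matrix.toEuclideanLin A (Matrix.toEuclideanLin (NormedSpace.exp ((t - s) • A)) v)) t := by
  have h1 : HasDerivAt (fun t : ℝ => NormedSpace.exp ((t - s) • A))
      (A * NormedSpace.exp ((t - s) • A)) t :=
    (hasDerivAt_exp_smul_const' (𝕂 := ℝ) A (t - s)).comp_sub_const t s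
  let ev : Matrix (Fin n) (Fin n) ℝ →ₗ[ℝ] EuclideanSpace ℝ (Fin n) :=
    (LinearMap.applyₗ v).comp (Matrix.toEuclideanLin (𝕜 := ℝ) (m := Fin n) (n := Fin n)).toLinearMap
  have h2 := (LinearMap.toContinuousLinearMap ev).hasFDerivAt.comp_hasDerivAt t h1
  refine h2.congr_deriv ?_
  change Matrix.toEuclideanLin (A * NormedSpace.exp ((t - s) • A)) v = _
  rw [toEuclideanLin_mul]

lemma continuous_exp_smul (A : Matrix (Fin n) (Fin n) ℝ) :
    Continuous fun t : ℝ => NormedSpace.exp (t • A) :=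
  continuous_iff_continuousAt.2 fun t =>
    (hasDerivAt_exp_smul_const' (𝕂 := ℝ) A t).continuousAt

end Exp

/-- If the sampling instants of an edge had a finite limit `T`, the smallest such limit of all
edges, then its trigger would read samples whose error tends to zero against `κ ρ(T) > 0`. -/
lemma IsClosedLoop.tendsto_ts (h : IsClosedLoop d S) (ha : IsAdjacencyMatrix G a)
    {i j : Fin N} (hij : G.Adj i j) : Filter.Tendsto (S.ts i j) Filter.atTop Filter.atTop := by
  classical
  by_contra hnot
  have hdich : ∀ e : Fin N × Fin N, ∃ T : ℝ, G.Adj e.1 e.2 →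
      Filter.Tendsto (S.ts e.1 e.2) Filter.atTop Filter.atTop ∨
        Filter.Tendsto (S.ts e.1 e.2) Filter.atTop (nhds T) := by
    intro e
    by_cases he : G.Adj e.1 e.2
    · rcases tendsto_atTop_of_monotone (h.ts_strictMono he).monotone with h1 | ⟨T, hT⟩
      · exact ⟨0, fun _ => Or.inl h1⟩
      · exact ⟨T, fun _ => Or.inr hT⟩
    · exact ⟨0, fun he' => (he he').elim⟩
  choose T hT using hdich
  -- `(l, q)` is an edge whose sampling instants accumulate first
  obtain ⟨⟨l, q⟩, he, hmin⟩ := Finset.exists_min_image (Finset.univ.filter fun e : Fin N × Fin N =>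
    G.Adj e.1 e.2 ∧ ¬ Filter.Tendsto (S.ts e.1 e.2) Filter.atTop Filter.atTop) T
    ⟨(i, j), by simp [hij, hnot]⟩
  simp only [Finset.mem_filter, Finset.mem_univ, true_and, and_imp] at he hmin
  obtain ⟨hlq, hlq'⟩ := he
  have hlim : Filter.Tendsto (S.ts l q) Filter.atTop (nhds (T (l, q))) :=
    (hT (l, q) hlq).resolve_left hlq'
  set τ := T (l, q) with hτ
  have hτ0 : 0 ≤ τ := ge_of_tendsto' hlim (h.ts_nonneg hlq)
  have hr : ∀ t, 0 ≤ t → t < τ → S.Reached G t := by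
    intro t _ htτ i' j' hij'
    by_cases ht' : Filter.Tendsto (S.ts i' j') Filter.atTop Filter.atTop
    · exact (ht'.eventually_gt_atTop t).exists
    · have h1 := (hT (i', j') hij').resolve_left ht'
      exact (h1.eventually_const_lt (htτ.trans_le (hmin (i', j') hij' ht'))).exists
  have hrho := h.rho_pos_of_reached ha hlq hτ0 hr
  have hlimW : Filter.Tendsto (S.ts l q) Filter.atTop (nhdsWithin τ (Set.Ici 0)) :=
    tendsto_nhdsWithin_iff.2 ⟨hlim, Filter.Eventually.of_forall (h.ts_nonneg hlq)⟩
  have hx : Filter.Tendsto (fun k => S.xhat l (S.ts l q k)) Filter.atTop (nhds (S.xhat l τ)) :=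
    (h.xhat_cont l τ hτ0).tendsto.comp hlimW
  have hr' : Filter.Tendsto (fun k => S.rho l q (S.ts l q (k + 1))) Filter.atTop
      (nhds (S.rho l q τ)) :=
    ((h.rho_cont l q hlq τ hτ0).tendsto.comp hlimW).comp (Filter.tendsto_add_atTop_nat 1)
  have hgap : Filter.Tendsto (fun k => S.ts l q (k + 1) - S.ts l q k) Filter.atTop (nhds 0) := by
    simpa using (hlim.comp (Filter.tendsto_add_atTop_nat 1)).sub hlim
  have hheld : Filter.Tendsto (fun k => S.held A l q k (S.ts l q (k + 1))) Filter.atTop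
      (nhds (S.xhat l τ)) := by
    have h1 := ((continuous_exp_smul A).tendsto 0).comp hgap
    rw [zero_smul, NormedSpace.exp_zero] at h1
    have hc : Continuous fun r : Matrix (Fin n) (Fin n) ℝ × EuclideanSpace ℝ (Fin n) =>
        Matrix.toEuclideanLin r.1 r.2 := by
      simp only [Matrix.toLpLin_apply]
      exact (PiLp.continuous_toLp 2 _).comp
        (continuous_fst.matrix_mulVec ((PiLp.continuous_ofLp 2 _).comp continuous_snd))
    have h2 := (hc.tendsto (1, S.xhat l τ)).comp (h1.prodMk_nhds hx)
    rw [toEuclideanLin_one] at h2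
    exact h2
  have herr : Filter.Tendsto (fun k => 4 * a l q * ‖d.undetPart l
      (S.held A l q k (S.ts l q (k + 1)) - S.xhat l (S.ts l q (k + 1)))‖ ^ 2)
      Filter.atTop (nhds 0) := by
    have h1 := hheld.sub (hx.comp (Filter.tendsto_add_atTop_nat 1))
    rw [sub_self] at h1
    have h2 := ((((LinearMap.continuous_of_finiteDimensional (d.undetPart l)).tendsto 0).comp
      h1).norm.pow 2).const_mul (4 * a l q)
    simpa using h2
  have hle : ∀ᶠ k in Filter.atTop, d.kappa l q * S.rho l q (S.ts l q (k + 1)) ≤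
      4 * a l q * ‖d.undetPart l
        (S.held A l q k (S.ts l q (k + 1)) - S.xhat l (S.ts l q (k + 1)))‖ ^ 2 := by
    -- the gaps are eventually below `τ̄`, so that only the trigger function can cause a sample
    filter_upwards [hgap.eventually_lt_const (d.tauMax_pos l q hlq)] with k hk
    obtain ⟨z, hz, hz0⟩ := (h.fires l q hlq k).resolve_left (not_le.2 hk)
    rw [Design.trigger, Design.sampleError, hz.1] at hz0
    have h1 : 0 ≤ d.beta / (G.degree l : ℝ) * disagreement G a z l :=
      mul_nonneg (div_nonneg d.beta_pos.le (Nat.cast_nonneg _)) (disagreement_nonneg ha z l)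
    linarith
  have := le_of_tendsto_of_tendsto (hr'.const_mul (d.kappa l q)) herr hle
  have := mul_pos (d.kappa_pos l q hlq) hrho
  linarith

lemma IsClosedLoop.reached (h : IsClosedLoop d S) (ha : IsAdjacencyMatrix G a) (t : ℝ) :
    S.Reached G t := fun _ _ hij =>
  ((h.tendsto_ts ha hij).eventually_gt_atTop t).exists

lemma IsClosedLoop.rho_pos (h : IsClosedLoop d S) (ha : IsAdjacencyMatrix G a) {i j : Fin N}
    (hij : G.Adj i j) {t : ℝ} (ht : 0 ≤ t) : 0 < S.rho i j t :=
  h.rho_pos_of_reached ha hij ht fun s _ _ => h.reached ha s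

end ClosedLoop

/-! ### Decay of the detectable components -/

section ErrorDynamics

variable {N n : ℕ} {m : Fin N → ℕ} {A : Matrix (Fin n) (Fin n) ℝ}
  {H : ∀ i, Matrix (Fin (m i)) (Fin n) ℝ} {G : SimpleGraph (Fin N)} [DecidableRel G.Adj]
  {a : Matrix (Fin N) (Fin N) ℝ} {d : Design A H G a} {S : Signals N n}

/-- The estimation error `ηᵢ = x̂ᵢ - x`. -/
def Signals.err (S : Signals N n) (i : Fin N) (t : ℝ) : EuclideanSpace ℝ (Fin n) :=
  S.xhat i t - S.x t

/-- The difference `x̄_{ij} - x̄_{ji}` of the predictions on an edge. -/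
def Signals.gap (S : Signals N n) (i j : Fin N) (t : ℝ) : EuclideanSpace ℝ (Fin n) :=
  S.xbar i j t - S.xbar j i t

/-- The size `∑ ‖ηⱼ(0)‖² + ∑ ρ_{jk}(0)` of the initial data. -/
noncomputable def Signals.initialSize (S : Signals N n) (G : SimpleGraph (Fin N)) [DecidableRel G.Adj] : ℝ :=
  ∑ j, ‖S.err j 0‖ ^ 2 + ∑ j, ∑ k ∈ G.neighborFinset j, S.rho j k 0

lemma IsClosedLoop.sum_rho_nonneg (h : IsClosedLoop d S) (ha : IsAdjacencyMatrix G a) {t : ℝ}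
    (ht : 0 ≤ t) : 0 ≤ ∑ j, ∑ k ∈ G.neighborFinset j, S.rho j k t :=
  Finset.sum_nonneg fun _ _ => Finset.sum_nonneg fun _ hk =>
    (h.rho_pos ha ((G.mem_neighborFinset _ _).1 hk) ht).le

lemma IsClosedLoop.initialSize_nonneg (h : IsClosedLoop d S) (ha : IsAdjacencyMatrix G a) :
    0 ≤ S.initialSize G :=
  add_nonneg (Finset.sum_nonneg fun _ _ => sq_nonneg _) (h.sum_rho_nonneg ha le_rfl)

lemma IsClosedLoop.norm_err_zero_le (h : IsClosedLoop d S) (ha : IsAdjacencyMatrix G a)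
    (i : Fin N) : ‖S.err i 0‖ ≤ √(S.initialSize G) := by
  refine Real.le_sqrt_of_sq_le ?_
  have h1 := Finset.single_le_sum (f := fun j => ‖S.err j 0‖ ^ 2) (fun _ _ => sq_nonneg _)
    (Finset.mem_univ i)
  have h2 := h.sum_rho_nonneg ha le_rfl
  unfold Signals.initialSize
  linarith

lemma IsClosedLoop.err_continuousOn (h : IsClosedLoop d S) (i : Fin N) :
    ContinuousOn (S.err i) (Set.Ici 0) :=
  (h.xhat_cont i).sub fun t ht => (h.plant t ht).continuousWithinAt

lemma IsClosedLoop.err_deriv (h : IsClosedLoop d S) (ha : IsAdjacencyMatrix G a) (i : Fin N)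
    {t : ℝ} (ht : 0 ≤ t) :
    HasDerivWithinAt (S.err i)
      (Matrix.toEuclideanLin A (S.err i t)
        - Matrix.toEuclideanLin (d.D i) (Matrix.toEuclideanLin (d.Ld i)
            (Matrix.toEuclideanLin (H i) (S.err i t)))
        - d.c • Matrix.toEuclideanLin (d.U i) (d.undetPart i (∑ j, a i j • S.gap i j t)))
      (Set.Ici t) t := by
  have h1 := (h.observer i t ht (h.reached ha t)).sub
    ((h.plant t ht).mono (Set.Ici_subset_Ici.2 ht))
  refine h1.congr_deriv ?_
  rw [ha.sum_neighborFinset, d.L_apply, d.M_apply]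
  simp only [Signals.err, Signals.gap, map_sub]
  abel

lemma IsClosedLoop.detPart_err_deriv (h : IsClosedLoop d S) (ha : IsAdjacencyMatrix G a)
    (i : Fin N) {t : ℝ} (ht : 0 ≤ t) :
    HasDerivWithinAt (fun t => d.detPart i (S.err i t))
      (Matrix.toEuclideanLin ((d.D i)ᵀ * A * d.D i - d.Ld i * (H i * d.D i))
        (d.detPart i (S.err i t))) (Set.Ici t) t := by
  refine (hasDerivWithinAt_linearMap_comp (d.detPart i) (h.err_deriv ha i ht)).congr_deriv ?_
  rw [map_sub, map_sub, map_smul, d.detPart_U, smul_zero, sub_zero, d.detPart_A,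
    (d.D_basis i).transpose_apply, d.H_apply, map_sub, LinearMap.sub_apply,
    toEuclideanLin_mul (d.Ld i)]

lemma exists_detPart_err_decay (d : Design A H G a) (ha : IsAdjacencyMatrix G a) :
    ∃ l : ℝ, 0 < l ∧ ∃ C : ℝ, 0 ≤ C ∧ ∀ S : Signals N n, IsClosedLoop d S →
      ∀ i t, 0 ≤ t → ‖d.detPart i (S.err i t)‖
        ≤ C * √(S.initialSize G) * Real.exp (-l * t) := by
  choose l hl C hC hdec using fun i => (d.hurwitz i).exists_decaysAt
  obtain ⟨e, he, hle⟩ := exists_pos_forall_le (fun _ => True) l fun i _ => hl i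
  obtain ⟨K, hK, hCK⟩ := exists_nonneg_forall_ge C
  refine ⟨e, he, K, hK, fun S h i t ht => ?_⟩
  have h1 := ((hdec i).mono (hC i) (hle i trivial) (hCK i)) (fun t => d.detPart i (S.err i t))
    (continuousOn_linearMap_comp _ (h.err_continuousOn i))
    (fun t ht => h.detPart_err_deriv ha i ht) t ht
  have h2 : ‖d.detPart i (S.err i 0)‖ ≤ √(S.initialSize G) :=
    (d.norm_detPart_le i _).trans (h.norm_err_zero_le ha i)
  refine h1.trans ?_
  gcongr

/-- The detectable component of a prediction error is at most an exponential multiple of that of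
the estimation error at the last sampling instant, which is at most `τ̄` ago. -/
lemma IsClosedLoop.norm_detPart_prediction_le (h : IsClosedLoop d S)
    (ha : IsAdjacencyMatrix G a) {i j : Fin N} (hij : G.Adj i j) {t : ℝ} (ht : 0 ≤ t) :
    ∃ s, 0 ≤ s ∧ t - d.tauMax i j ≤ s ∧ s ≤ t ∧
      ‖d.detPart i (S.xbar i j t - S.x t)‖ ≤ ‖d.detPart i (S.err i s)‖ *
        Real.exp (‖Matrix.toEuclideanCLM (n := _) (𝕜 := ℝ) ((d.D i)ᵀ * A * d.D i)‖
          * d.tauMax i j) := by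
  obtain ⟨k, hk⟩ := h.exists_mem_Ico hij ht (h.reached ha t)
  have hs := h.ts_nonneg hij k
  set s := S.ts i j k with hs_def
  have hτ : t - d.tauMax i j ≤ s := by
    -- `not_before` says nothing at the sampling instant itself, where the elapsed time is zero
    rcases eq_or_lt_of_le hk.1 with h0 | hlt
    · have := d.tauMax_pos i j hij
      linarith
    · have := h.not_before i j hij k t ⟨hlt, hk.2⟩
      rw [not_or, not_le] at this
      have := this.2
      linarith
  refine ⟨s, hs, hτ, hk.1, ?_⟩
  set Ad := (d.D i)ᵀ * A * d.D i with hAd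
  have hder : ∀ u, 0 ≤ u → HasDerivWithinAt (fun u => d.detPart i (S.held A i j k u - S.x u))
      (Matrix.toEuclideanLin Ad (d.detPart i (S.held A i j k u - S.x u))) (Set.Ici u) u := by
    intro u hu
    have h1 := (hasDerivAt_exp_smul_apply A s u (S.xhat i s)).hasDerivWithinAt (s := Set.Ici u)
    have h2 := h1.sub ((h.plant u hu).mono (Set.Ici_subset_Ici.2 hu))
    refine (hasDerivWithinAt_linearMap_comp (d.detPart i) h2).congr_deriv ?_
    rw [← map_sub (Matrix.toEuclideanLin A), d.detPart_A]
    rfl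
  have hcont : ContinuousOn (fun u => d.detPart i (S.held A i j k u - S.x u)) (Set.Icc s t) := by
    refine continuousOn_linearMap_comp _ (ContinuousOn.sub ?_ ?_)
    · exact fun u _ =>
        (hasDerivAt_exp_smul_apply A s u (S.xhat i s)).continuousAt.continuousWithinAt
    · exact fun u hu => ((h.plant u (hs.trans hu.1)).continuousWithinAt).mono
        (fun v hv => hs.trans hv.1)
  have hG := norm_le_gronwallBound_of_norm_deriv_right_le hcont
    (fun u hu => hder u (hs.trans hu.1)) le_rfl
    (fun u _ => by
      rw [add_zero]
      exact (Matrix.toEuclideanCLM (n := _) (𝕜 := ℝ) Ad).le_opNorm _) t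
    ⟨hk.1, le_rfl⟩
  rw [gronwallBound_ε0, hs_def, S.held_self, ← hs_def, ← h.xbar_eq i j hij k t hk] at hG
  refine hG.trans ?_
  have hle : t - s ≤ d.tauMax i j := by linarith
  change ‖d.detPart i (S.err i s)‖ * _ ≤ _
  gcongr

lemma exists_detPart_decay (d : Design A H G a) (ha : IsAdjacencyMatrix G a) :
    ∃ l : ℝ, 0 < l ∧ ∃ C : ℝ, 0 ≤ C ∧ ∀ S : Signals N n, IsClosedLoop d S →
      (∀ i t, 0 ≤ t → ‖d.detPart i (S.err i t)‖ ≤ C * √(S.initialSize G) * Real.exp (-l * t)) ∧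
      ∀ i j, G.Adj i j → ∀ t, 0 ≤ t →
        ‖d.detPart i (S.xbar i j t - S.x t)‖ ≤ C * √(S.initialSize G) * Real.exp (-l * t) := by
  obtain ⟨l, hl, C, hC, hdec⟩ := exists_detPart_err_decay d ha
  obtain ⟨K, hK, hKle⟩ := exists_nonneg_forall_ge fun e : Fin N × Fin N =>
    Real.exp (l * d.tauMax e.1 e.2) *
      Real.exp (‖Matrix.toEuclideanCLM (n := _) (𝕜 := ℝ) ((d.D e.1)ᵀ * A * d.D e.1)‖
        * d.tauMax e.1 e.2)
  refine ⟨l, hl, C * (1 + K), by positivity, fun S h => ⟨fun i t ht => ?_, fun i j hij t ht => ?_⟩⟩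
  · refine (hdec S h i t ht).trans ?_
    gcongr
    nlinarith
  · obtain ⟨s, hs, hτs, hst, hle⟩ := h.norm_detPart_prediction_le ha hij ht
    have h1 := hdec S h i s hs
    have h2 : Real.exp (-l * s) ≤ Real.exp (l * d.tauMax i j) * Real.exp (-l * t) := by
      rw [← Real.exp_add]
      apply Real.exp_le_exp.2
      nlinarith
    have h3 := hKle (i, j)
    simp only at h3
    set X := Real.exp (‖Matrix.toEuclideanCLM (n := _) (𝕜 := ℝ) ((d.D i)ᵀ * A * d.D i)‖
        * d.tauMax i j)
    calc _ ≤ _ := hle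
      _ ≤ C * √(S.initialSize G) * (Real.exp (l * d.tauMax i j) * Real.exp (-l * t)) * X := by
        gcongr
        refine h1.trans ?_
        gcongr
      _ = C * √(S.initialSize G) * (Real.exp (l * d.tauMax i j) * X) * Real.exp (-l * t) := by
        ring
      _ ≤ C * √(S.initialSize G) * (1 + K) * Real.exp (-l * t) := by
        gcongr; linarith
      _ = _ := by ring

end ErrorDynamics

/-! ### The Lyapunov function -/

/-- The coupling term for `e_{ij} = (qᵢ + r_{ij}) - (qⱼ + r_{ji})`, by polarization. -/
lemma neg_two_mul_sum_inner_le {N : ℕ} {E : Type*} [NormedAddCommGroup E] [InnerProductSpace ℝ E]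
    {G : SimpleGraph (Fin N)} [DecidableRel G.Adj] {a : Matrix (Fin N) (Fin N) ℝ}
    (ha : IsAdjacencyMatrix G a) (q : Fin N → E) (r : Fin N → Fin N → E) {e : Fin N → Fin N → E}
    (he : ∀ i j, e i j = q i - q j + (r i j - r j i)) :
    -(2 * ∑ i, inner ℝ (q i) (∑ j, a i j • e i j))
      ≤ -energy a q - 1 / 2 * ∑ i, ∑ j, a i j * ‖e i j‖ ^ 2
        + 2 * ∑ i, ∑ j, a i j * ‖r i j‖ ^ 2 := by
  rw [sum_inner_sum_smul ha.symm q (fun i j => by rw [he i j, he j i]; abel), energy]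
  have hterm : ∀ i j, -(a i j * inner ℝ (q i - q j) (e i j))
      ≤ -(1 / 2 * (a i j * ‖q i - q j‖ ^ 2)) - 1 / 2 * (a i j * ‖e i j‖ ^ 2)
        + (a i j * ‖r i j‖ ^ 2 + a i j * ‖r j i‖ ^ 2) := by
    intro i j
    have h1 : ‖r i j - r j i‖ ^ 2
        = ‖e i j‖ ^ 2 - 2 * inner ℝ (q i - q j) (e i j) + ‖q i - q j‖ ^ 2 := by
      rw [real_inner_comm, ← norm_sub_sq_real, he i j, add_sub_cancel_left]
    have h2 : ‖r i j - r j i‖ ^ 2 ≤ 2 * (‖r i j‖ ^ 2 + ‖r j i‖ ^ 2) := by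
      have h3 := norm_sub_le (r i j) (r j i)
      have h4 := norm_nonneg (r i j - r j i)
      nlinarith [sq_nonneg (‖r i j‖ - ‖r j i‖)]
    have h3 := mul_nonneg (ha.nonneg i j) (sub_nonneg.2 h2)
    rw [h1] at h3
    linarith
  have hsym : ∑ i, ∑ j, a i j * ‖r j i‖ ^ 2 = ∑ i, ∑ j, a i j * ‖r i j‖ ^ 2 := by
    rw [Finset.sum_comm]
    exact Finset.sum_congr rfl fun i _ => Finset.sum_congr rfl fun j _ => by rw [ha.symm]
  have hsum := Finset.sum_le_sum fun i (_ : i ∈ Finset.univ) =>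
    Finset.sum_le_sum fun j (_ : j ∈ Finset.univ) => hterm i j
  simp only [Finset.sum_add_distrib, Finset.sum_sub_distrib, Finset.sum_neg_distrib,
    ← Finset.mul_sum, hsym] at hsum
  linarith

section Lyapunov

variable {N n : ℕ} {m : Fin N → ℕ} {A : Matrix (Fin n) (Fin n) ℝ}
  {H : ∀ i, Matrix (Fin (m i)) (Fin n) ℝ} {G : SimpleGraph (Fin N)} [DecidableRel G.Adj]
  {a : Matrix (Fin N) (Fin N) ℝ} {d : Design A H G a} {S : Signals N n}

/-- The right-hand side of the error dynamics. -/
noncomputable def Design.errRate (d : Design A H G a) (S : Signals N n) (i : Fin N) (t : ℝ) :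
    EuclideanSpace ℝ (Fin n) :=
  Matrix.toEuclideanLin A (S.err i t)
    - Matrix.toEuclideanLin (d.D i) (Matrix.toEuclideanLin (d.Ld i)
        (Matrix.toEuclideanLin (H i) (S.err i t)))
    - d.c • Matrix.toEuclideanLin (d.U i) (d.undetPart i (∑ j, a i j • S.gap i j t))

/-- The dissipation of `∑ ‖Uᵢᵀ ηᵢ‖²`. The gain condition absorbs the unstable drift, and the
terms left over are the ones balanced by the auxiliary variables and exponentially decaying
ones. -/
lemma sum_inner_undetPart_errRate_le (ha : IsAdjacencyMatrix G a) (hG : G.Connected)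
    (hdet : IsDetectable A (stack H)) (d : Design A H G a) (S : Signals N n) (t : ℝ) :
    ∑ i, 2 * inner ℝ (d.undetPart i (S.err i t)) (d.undetPart i (d.errRate S i t))
      ≤ -∑ i, ‖d.undetPart i (S.err i t)‖ ^ 2
        + ‖Matrix.toEuclideanCLM (n := _) (𝕜 := ℝ) A‖ ^ 2 * ∑ i, ‖d.detPart i (S.err i t)‖ ^ 2
        - d.c / 2 * ∑ i, ∑ j, a i j * ‖S.gap i j t‖ ^ 2
        + d.c / 2 * ∑ i, ∑ j, a i j * (4 * ‖d.undetPart i (S.xbar i j t - S.xhat i t)‖ ^ 2)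
        + 2 * d.c * ∑ i, ∑ j, a i j * ‖d.detPart i (S.xbar i j t - S.x t)‖ ^ 2 := by
  obtain ⟨hc, hgain⟩ := coupling_gain ha hG hdet d.U_basis d.eps_pos d.eps_lt d.c_ge
  set y : ∀ i, EuclideanSpace ℝ (Fin (undetDim A (H i))) := fun i => d.undetPart i (S.err i t)
    with hy
  set q : Fin N → EuclideanSpace ℝ (Fin n) := fun i => Matrix.toEuclideanLin (d.U i) (y i) with hq
  set r : Fin N → Fin N → EuclideanSpace ℝ (Fin n) := fun i j =>
    Matrix.toEuclideanLin (d.U i) (d.undetPart i (S.xbar i j t - S.xhat i t))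
      + Matrix.toEuclideanLin (d.D i) (d.detPart i (S.xbar i j t - S.x t)) with hr
  have hqr : ∀ i j, q i + r i j = S.xbar i j t - S.x t := by
    intro i j
    rw [← d.add_eq i (S.xbar i j t - S.x t), hr, hq]
    simp only
    rw [← add_assoc, ← map_add, hy]
    simp only
    rw [← map_add, Signals.err]
    congr 3
    abel
  have he : ∀ i j, S.gap i j t = q i - q j + (r i j - r j i) := by
    intro i j
    have h1 := hqr i j
    have h2 := hqr j i
    calc S.gap i j t = (S.xbar i j t - S.x t) - (S.xbar j i t - S.x t) := by
          rw [Signals.gap]; abel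
      _ = _ := by rw [← h1, ← h2]; abel
  have hcoup := neg_two_mul_sum_inner_le ha q r he
  have hgy : 2 * ∑ i, ‖y i‖ ^ 2 + ∑ i, 2 * inner ℝ (q i) (Matrix.toEuclideanLin A (q i))
      ≤ d.c * energy a q := hgain y
  have hrsq : ∀ i j, ‖r i j‖ ^ 2 = ‖d.undetPart i (S.xbar i j t - S.xhat i t)‖ ^ 2
      + ‖d.detPart i (S.xbar i j t - S.x t)‖ ^ 2 := fun i j => d.norm_sq_add i _ _
  have hterm : ∀ i, 2 * inner ℝ (y i) (d.undetPart i (d.errRate S i t))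
      ≤ 2 * inner ℝ (q i) (Matrix.toEuclideanLin A (q i)) + ‖y i‖ ^ 2
        + ‖Matrix.toEuclideanCLM (n := _) (𝕜 := ℝ) A‖ ^ 2 * ‖d.detPart i (S.err i t)‖ ^ 2
        - d.c * (2 * inner ℝ (q i) (∑ j, a i j • S.gap i j t)) := by
    intro i
    set w := Matrix.toEuclideanLin (d.D i) (d.detPart i (S.err i t)) with hw
    have hAe : Matrix.toEuclideanLin A (S.err i t)
        = Matrix.toEuclideanLin A (q i) + Matrix.toEuclideanLin A w := by
      rw [← map_add]
      exact congrArg _ (d.add_eq i (S.err i t)).symm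
    have h1 : inner ℝ (y i) (d.undetPart i (d.errRate S i t))
        = inner ℝ (q i) (Matrix.toEuclideanLin A (q i)) + inner ℝ (q i) (Matrix.toEuclideanLin A w)
          - d.c * inner ℝ (q i) (∑ j, a i j • S.gap i j t) := by
      rw [Design.errRate, map_sub, map_sub, map_smul, d.undetPart_D, sub_zero,
        (d.U_basis i).transpose_apply, inner_sub_right, inner_smul_right, ← inner_toEuclideanLin,
        ← inner_toEuclideanLin, hAe, inner_add_right]
    have h2 : inner ℝ (q i) (Matrix.toEuclideanLin A w)
        ≤ ‖y i‖ * (‖Matrix.toEuclideanCLM (n := _) (𝕜 := ℝ) A‖ * ‖d.detPart i (S.err i t)‖) := by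
      refine (real_inner_le_norm _ _).trans ?_
      rw [hq, (d.U_basis i).norm_apply, ← (d.D_basis i).norm_apply (d.detPart i _)]
      gcongr
      exact (Matrix.toEuclideanCLM (n := _) (𝕜 := ℝ) A).le_opNorm w
    rw [h1]
    nlinarith [sq_nonneg (‖y i‖ - ‖Matrix.toEuclideanCLM (n := _) (𝕜 := ℝ) A‖
      * ‖d.detPart i (S.err i t)‖)]
  have hsum := Finset.sum_le_sum fun i (_ : i ∈ Finset.univ) => hterm i
  simp only [hrsq, mul_add, Finset.sum_add_distrib] at hcoup
  simp only [Finset.sum_sub_distrib, Finset.sum_add_distrib, ← Finset.mul_sum] at hsum hgy ⊢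
  have hcoup' := mul_le_mul_of_nonneg_left hcoup hc
  have hX : ∑ i, ∑ j, a i j * (4 * ‖d.undetPart i (S.xbar i j t - S.xhat i t)‖ ^ 2)
      = 4 * ∑ i, ∑ j, a i j * ‖d.undetPart i (S.xbar i j t - S.xhat i t)‖ ^ 2 := by
    simp only [Finset.mul_sum]
    exact Finset.sum_congr rfl fun i _ => Finset.sum_congr rfl fun j _ => by ring
  rw [hX]
  linarith

/-- The right-hand side of the dynamics of `ρ_{ij}`. -/
noncomputable def Design.rhoRate (d : Design A H G a) (S : Signals N n) (i j : Fin N) (t : ℝ) :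
    ℝ :=
  - d.delta i j * S.rho i j t - d.sampleError (fun l q => S.xbar l q t) (S.xhat i t) i j
    + d.beta / (G.degree i : ℝ) * disagreement G a (fun l q => S.xbar l q t) i
    + d.gamma i j *
      ‖Matrix.toEuclideanLin (H i) (S.xhat i t) - Matrix.toEuclideanLin (H i) (S.x t)‖ ^ 2

lemma IsClosedLoop.sum_rhoRate_le (h : IsClosedLoop d S) (ha : IsAdjacencyMatrix G a) {μ : ℝ}
    (hμ : ∀ i j, G.Adj i j → μ ≤ d.delta i j) {t : ℝ} (ht : 0 ≤ t) :
    ∑ i, ∑ j ∈ G.neighborFinset i, d.rhoRate S i j t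
      ≤ -μ * ∑ i, ∑ j ∈ G.neighborFinset i, S.rho i j t
        - ∑ i, ∑ j, a i j * (4 * ‖d.undetPart i (S.xbar i j t - S.xhat i t)‖ ^ 2)
        + ∑ i, ∑ j, a i j * ‖S.gap i j t‖ ^ 2
        + ∑ i, (∑ j ∈ G.neighborFinset i, d.gamma i j)
          * ‖Matrix.toEuclideanLin (H i) (S.err i t)‖ ^ 2 := by
  have hterm : ∀ i, ∑ j ∈ G.neighborFinset i, d.rhoRate S i j t
      ≤ -μ * ∑ j ∈ G.neighborFinset i, S.rho i j t
        - ∑ j, a i j * (4 * ‖d.undetPart i (S.xbar i j t - S.xhat i t)‖ ^ 2)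
        + ∑ j, a i j * ‖S.gap i j t‖ ^ 2
        + (∑ j ∈ G.neighborFinset i, d.gamma i j)
          * ‖Matrix.toEuclideanLin (H i) (S.err i t)‖ ^ 2 := by
    intro i
    have h1 : ∑ j ∈ G.neighborFinset i, -d.delta i j * S.rho i j t
        ≤ -μ * ∑ j ∈ G.neighborFinset i, S.rho i j t := by
      rw [Finset.mul_sum]
      refine Finset.sum_le_sum fun j hj => ?_
      have hij := (G.mem_neighborFinset _ _).1 hj
      have := mul_le_mul_of_nonneg_right (hμ i j hij) (h.rho_pos ha hij ht).le
      linarith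
    have h2 : ∑ j ∈ G.neighborFinset i,
        d.sampleError (fun l q => S.xbar l q t) (S.xhat i t) i j
        = ∑ j, a i j * (4 * ‖d.undetPart i (S.xbar i j t - S.xhat i t)‖ ^ 2) := by
      refine Eq.trans (Finset.sum_congr rfl fun j _ => ?_) (ha.sum_neighborFinset i fun j =>
        4 * ‖d.undetPart i (S.xbar i j t - S.xhat i t)‖ ^ 2)
      rw [Design.sampleError, smul_eq_mul]
      ring
    have hdis : disagreement G a (fun l q => S.xbar l q t) i
        = ∑ j, a i j * ‖S.gap i j t‖ ^ 2 :=
      ha.sum_neighborFinset i fun j => ‖S.gap i j t‖ ^ 2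
    have h3 : ∑ j ∈ G.neighborFinset i,
        d.beta / (G.degree i : ℝ) * disagreement G a (fun l q => S.xbar l q t) i
        ≤ ∑ j, a i j * ‖S.gap i j t‖ ^ 2 := by
      rw [← hdis, Finset.sum_const, G.card_neighborFinset_eq_degree, nsmul_eq_mul]
      have hd := disagreement_nonneg ha (fun l q => S.xbar l q t) i
      -- for an isolated agent the quotient is a junk value, but then the sum is empty
      rcases Nat.eq_zero_or_pos (G.degree i) with h0 | hpos
      · rw [h0, Nat.cast_zero, zero_mul]; exact hd
      · have : (0 : ℝ) < G.degree i := by exact_mod_cast hpos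
        rw [← mul_assoc, mul_div_cancel₀ _ this.ne']
        have := d.beta_lt
        nlinarith
    have h4 : ∑ j ∈ G.neighborFinset i, d.gamma i j *
        ‖Matrix.toEuclideanLin (H i) (S.xhat i t) - Matrix.toEuclideanLin (H i) (S.x t)‖ ^ 2
        = (∑ j ∈ G.neighborFinset i, d.gamma i j)
          * ‖Matrix.toEuclideanLin (H i) (S.err i t)‖ ^ 2 := by
      rw [← Finset.sum_mul, Signals.err, map_sub]
    simp only [Design.rhoRate, Finset.sum_add_distrib, Finset.sum_sub_distrib]
    rw [h2, h4]
    linarith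
  have hsum := Finset.sum_le_sum fun i (_ : i ∈ Finset.univ) => hterm i
  simp only [Finset.sum_add_distrib, Finset.sum_sub_distrib] at hsum
  rwa [← Finset.mul_sum _ _ (-μ)] at hsum

/-- The Lyapunov function `∑ ‖Uᵢᵀ ηᵢ‖² + (c / 2) ∑ ρ_{ij}`. -/
noncomputable def Design.lyap (d : Design A H G a) (S : Signals N n) (t : ℝ) : ℝ :=
  ∑ i, ‖d.undetPart i (S.err i t)‖ ^ 2
    + d.c / 2 * ∑ i, ∑ j ∈ G.neighborFinset i, S.rho i j t

/-- The right derivative of the Lyapunov function. -/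
noncomputable def Design.lyapRate (d : Design A H G a) (S : Signals N n) (t : ℝ) : ℝ :=
  ∑ i, 2 * inner ℝ (d.undetPart i (S.err i t)) (d.undetPart i (d.errRate S i t))
    + d.c / 2 * ∑ i, ∑ j ∈ G.neighborFinset i, d.rhoRate S i j t

lemma IsClosedLoop.lyap_deriv (h : IsClosedLoop d S) (ha : IsAdjacencyMatrix G a) {t : ℝ}
    (ht : 0 ≤ t) : HasDerivWithinAt (d.lyap S) (d.lyapRate S t) (Set.Ici t) t := by
  refine HasDerivWithinAt.add (HasDerivWithinAt.fun_sum fun i _ => ?_)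
    (HasDerivWithinAt.const_mul _ (HasDerivWithinAt.fun_sum fun i _ =>
      HasDerivWithinAt.fun_sum fun j hj => ?_))
  · exact (hasDerivWithinAt_linearMap_comp (d.undetPart i) (h.err_deriv ha i ht)).norm_sq
  · exact h.rho_deriv i j ((G.mem_neighborFinset _ _).1 hj) t ht (h.reached ha t)

lemma IsClosedLoop.lyap_continuousOn (h : IsClosedLoop d S) :
    ContinuousOn (d.lyap S) (Set.Ici 0) := by
  refine ContinuousOn.add (continuousOn_finsetSum _ fun i _ => ?_)
    (ContinuousOn.mul continuousOn_const (continuousOn_finsetSum _ fun i _ =>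
      continuousOn_finsetSum _ fun j hj => ?_))
  · exact (continuousOn_linearMap_comp (d.undetPart i) (h.err_continuousOn i)).norm.pow 2
  · exact h.rho_cont i j ((G.mem_neighborFinset _ _).1 hj)

/-- A scalar comparison principle: a forcing that decays faster than `e^{-μ t}` does not destroy
the decay at the rate `μ`. -/
lemma le_exp_of_deriv_le {f f' : ℝ → ℝ} {μ ν K : ℝ} (hν : μ < ν) (hK : 0 ≤ K)
    (hf : ContinuousOn f (Set.Ici 0))
    (hf' : ∀ t, 0 ≤ t → HasDerivWithinAt f (f' t) (Set.Ici t) t)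
    (hle : ∀ t, 0 ≤ t → f' t ≤ -μ * f t + K * Real.exp (-ν * t)) {t : ℝ} (ht : 0 ≤ t) :
    f t ≤ (f 0 + K / (ν - μ)) * Real.exp (-μ * t) := by
  have hνμ : 0 < ν - μ := sub_pos.2 hν
  have hexp : ∀ c s : ℝ, HasDerivAt (fun s => Real.exp (c * s)) (Real.exp (c * s) * c) s := by
    intro c s
    have h1 : HasDerivAt (fun s : ℝ => c * s) c s := by
      simpa using (hasDerivAt_id s).const_mul c
    exact h1.exp
  have h := image_le_of_deriv_right_le_deriv_boundary
    (f := fun s => Real.exp (μ * s) * f s) (a := 0) (b := t)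
    (B := fun s => f 0 + K / (ν - μ) * (1 - Real.exp (-(ν - μ) * s)))
    (B' := fun s => K / (ν - μ) * (-(Real.exp (-(ν - μ) * s) * -(ν - μ))))
    (ContinuousOn.mul (by fun_prop) (hf.mono Set.Icc_subset_Ici_self))
    (fun s hs => (hexp μ s).hasDerivWithinAt.mul (hf' s hs.1))
    (by simp)
    (by fun_prop)
    (fun s _ => ((((hexp _ s).const_sub 1).const_mul _).const_add _).hasDerivWithinAt)
    (by
      intro s hs
      have h1 := mul_le_mul_of_nonneg_left (hle s hs.1) (Real.exp_pos (μ * s)).le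
      have h2 : K / (ν - μ) * (-(Real.exp (-(ν - μ) * s) * -(ν - μ)))
          = K * Real.exp (-(ν - μ) * s) := by
        field_simp
      have h3 : Real.exp (μ * s) * (K * Real.exp (-ν * s)) = K * Real.exp (-(ν - μ) * s) := by
        rw [mul_left_comm, ← Real.exp_add]
        congr 2
        ring
      rw [h2, ← h3]
      linarith)
    (Set.right_mem_Icc.2 ht)
  have h1 : f t = Real.exp (-μ * t) * (Real.exp (μ * t) * f t) := by
    rw [← mul_assoc, ← Real.exp_add]
    simp
  rw [h1, mul_comm _ (Real.exp (-μ * t))]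
  gcongr
  refine h.trans ?_
  have h2 : 0 ≤ K / (ν - μ) * Real.exp (-(ν - μ) * t) := by positivity
  linarith

/-- The Lyapunov function decays exponentially: its rate is at most `-μ` times itself plus the
contribution of the detectable components. -/
lemma exists_undetPart_decay (ha : IsAdjacencyMatrix G a) (hG : G.Connected)
    (hdet : IsDetectable A (stack H)) (d : Design A H G a) {l C : ℝ} (hl : 0 < l)
    (hdec : ∀ S : Signals N n, IsClosedLoop d S →
      (∀ i t, 0 ≤ t → ‖d.detPart i (S.err i t)‖ ≤ C * √(S.initialSize G) * Real.exp (-l * t)) ∧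
      ∀ i j, G.Adj i j → ∀ t, 0 ≤ t →
        ‖d.detPart i (S.xbar i j t - S.x t)‖ ≤ C * √(S.initialSize G) * Real.exp (-l * t)) :
    ∃ μ : ℝ, 0 < μ ∧ μ ≤ l ∧ ∃ K : ℝ, 0 ≤ K ∧ ∀ S : Signals N n, IsClosedLoop d S →
      ∀ i t, 0 ≤ t → ‖d.undetPart i (S.err i t)‖ ^ 2 ≤ K * S.initialSize G * Real.exp (-μ * t) := by
  have hc : 0 ≤ d.c := (coupling_gain ha hG hdet d.U_basis d.eps_pos d.eps_lt d.c_ge).1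
  obtain ⟨δ, hδ, hδle⟩ := exists_pos_forall_le (fun e : Fin N × Fin N => G.Adj e.1 e.2)
    (fun e => d.delta e.1 e.2) fun e he => d.delta_pos e.1 e.2 he
  -- `1` is the decay rate from `coupling_gain`, `δ` that of `ρ`, and `μ ≤ l < 2 l` keeps the
  -- forcing faster than `W`
  set μ := min (min 1 δ) l with hμ
  have hμ0 : 0 < μ := lt_min (lt_min one_pos hδ) hl
  have hμ1 : μ ≤ 1 := (min_le_left _ _).trans (min_le_left _ _)
  have hμδ : μ ≤ δ := (min_le_left _ _).trans (min_le_right _ _)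
  have hμl : μ ≤ l := min_le_right _ _
  set nH : Fin N → ℝ := fun i => ‖LinearMap.toContinuousLinearMap
    (Matrix.toEuclideanLin (H i * d.D i))‖ with hnH
  set nA : ℝ := ‖Matrix.toEuclideanCLM (n := _) (𝕜 := ℝ) A‖ with hnA
  set K₀ : ℝ := nA ^ 2 * (∑ _i : Fin N, C ^ 2) + 2 * d.c * (∑ i, ∑ j, a i j * C ^ 2)
    + d.c / 2 * ∑ i, (∑ j ∈ G.neighborFinset i, d.gamma i j) * (nH i ^ 2 * C ^ 2) with hK₀
  have hγ : ∀ i, 0 ≤ ∑ j ∈ G.neighborFinset i, d.gamma i j := fun i =>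
    Finset.sum_nonneg fun j hj => (d.gamma_pos i j ((G.mem_neighborFinset _ _).1 hj)).le
  have hK₀0 : 0 ≤ K₀ := by
    have h1 : 0 ≤ ∑ i, ∑ j, a i j * C ^ 2 := Finset.sum_nonneg fun i _ =>
      Finset.sum_nonneg fun j _ => mul_nonneg (ha.nonneg i j) (sq_nonneg _)
    have h2 : 0 ≤ ∑ i, (∑ j ∈ G.neighborFinset i, d.gamma i j) * (nH i ^ 2 * C ^ 2) :=
      Finset.sum_nonneg fun i _ => mul_nonneg (hγ i) (by positivity)
    positivity
  refine ⟨μ, hμ0, hμl, 1 + d.c / 2 + K₀ / (2 * l - μ),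
    by have : 0 < 2 * l - μ := by linarith
       positivity, fun S h i t ht => ?_⟩
  set R := S.initialSize G with hR
  have hR0 : 0 ≤ R := h.initialSize_nonneg ha
  obtain ⟨hd1, hd2⟩ := hdec S h
  have hsq : ∀ {x s : ℝ}, 0 ≤ x → x ≤ C * √R * Real.exp (-l * s) →
      x ^ 2 ≤ C ^ 2 * (R * Real.exp (-(2 * l) * s)) := by
    intro x s hx hxs
    have h1 := pow_le_pow_left₀ hx hxs 2
    have h2 : Real.exp (-l * s) ^ 2 = Real.exp (-(2 * l) * s) := by
      rw [sq, ← Real.exp_add]; congr 1; ring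
    rwa [mul_pow, mul_pow, Real.sq_sqrt hR0, h2, mul_assoc] at h1
  have hrate : ∀ s, 0 ≤ s →
      d.lyapRate S s ≤ -μ * d.lyap S s + K₀ * R * Real.exp (-(2 * l) * s) := by
    intro s hs
    set E := R * Real.exp (-(2 * l) * s) with hE
    have h1 := sum_inner_undetPart_errRate_le ha hG hdet d S s
    have h2 := mul_le_mul_of_nonneg_left (h.sum_rhoRate_le ha
      (fun i j hij => hμδ.trans (hδle (i, j) hij)) hs) (by positivity : 0 ≤ d.c / 2)
    have h3 : ∑ i, ‖d.detPart i (S.err i s)‖ ^ 2 ≤ (∑ _i : Fin N, C ^ 2) * E := by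
      rw [Finset.sum_mul]
      exact Finset.sum_le_sum fun i _ => hsq (norm_nonneg _) (hd1 i s hs)
    have h4 : ∑ i, ∑ j, a i j * ‖d.detPart i (S.xbar i j s - S.x s)‖ ^ 2
        ≤ (∑ i, ∑ j, a i j * C ^ 2) * E := by
      simp only [Finset.sum_mul]
      refine Finset.sum_le_sum fun i _ => Finset.sum_le_sum fun j _ => ?_
      by_cases hij : G.Adj i j
      · rw [mul_assoc]
        exact mul_le_mul_of_nonneg_left (hsq (norm_nonneg _) (hd2 i j hij s hs)) (ha.nonneg i j)
      · simp [ha.zero i j hij]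
    have h5 : ∑ i, (∑ j ∈ G.neighborFinset i, d.gamma i j)
          * ‖Matrix.toEuclideanLin (H i) (S.err i s)‖ ^ 2
        ≤ (∑ i, (∑ j ∈ G.neighborFinset i, d.gamma i j) * (nH i ^ 2 * C ^ 2)) * E := by
      rw [Finset.sum_mul]
      refine Finset.sum_le_sum fun i _ => ?_
      rw [mul_assoc, mul_assoc]
      refine mul_le_mul_of_nonneg_left ?_ (hγ i)
      have h6 : ‖Matrix.toEuclideanLin (H i) (S.err i s)‖
          ≤ nH i * ‖d.detPart i (S.err i s)‖ := by
        rw [d.H_apply]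
        exact (LinearMap.toContinuousLinearMap
          (Matrix.toEuclideanLin (H i * d.D i))).le_opNorm _
      refine (pow_le_pow_left₀ (norm_nonneg _) h6 2).trans ?_
      rw [mul_pow]
      exact mul_le_mul_of_nonneg_left (hsq (norm_nonneg _) (hd1 i s hs)) (sq_nonneg _)
    have h3' := mul_le_mul_of_nonneg_left h3 (sq_nonneg nA)
    have h4' := mul_le_mul_of_nonneg_left h4 (by positivity : 0 ≤ 2 * d.c)
    have h5' := mul_le_mul_of_nonneg_left h5 (by positivity : 0 ≤ d.c / 2)
    have hV : 0 ≤ ∑ i, ‖d.undetPart i (S.err i s)‖ ^ 2 := Finset.sum_nonneg fun _ _ => sq_nonneg _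
    have hV' := mul_le_mul_of_nonneg_right hμ1 hV
    rw [mul_assoc K₀, ← hE, hK₀, Design.lyapRate, Design.lyap]
    linarith
  have hfin := le_exp_of_deriv_le (by linarith : μ < 2 * l) (by positivity : 0 ≤ K₀ * R)
    h.lyap_continuousOn (fun s hs => h.lyap_deriv ha hs) hrate ht
  have h0 : d.lyap S 0 ≤ (1 + d.c / 2) * R := by
    have h1 : ∑ j, ‖d.undetPart j (S.err j 0)‖ ^ 2 ≤ ∑ j, ‖S.err j 0‖ ^ 2 :=
      Finset.sum_le_sum fun j _ => pow_le_pow_left₀ (norm_nonneg _) (d.norm_undetPart_le j _) 2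
    have h2 := h.sum_rho_nonneg ha le_rfl
    have h3 : 0 ≤ ∑ j, ‖S.err j 0‖ ^ 2 := Finset.sum_nonneg fun _ _ => sq_nonneg _
    have h4 : 0 ≤ d.c / 2 * ∑ j, ‖S.err j 0‖ ^ 2 := by positivity
    rw [hR, Design.lyap, Signals.initialSize]
    linarith
  have hi : ‖d.undetPart i (S.err i t)‖ ^ 2 ≤ d.lyap S t := by
    have h1 := Finset.single_le_sum (f := fun j => ‖d.undetPart j (S.err j t)‖ ^ 2)
      (fun _ _ => sq_nonneg _) (Finset.mem_univ i)
    have h2 : 0 ≤ d.c / 2 * ∑ j, ∑ k ∈ G.neighborFinset j, S.rho j k t :=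
      mul_nonneg (by positivity) (h.sum_rho_nonneg ha ht)
    rw [Design.lyap]
    linarith
  refine hi.trans (hfin.trans ?_)
  gcongr
  calc _ ≤ (1 + d.c / 2) * R + K₀ * R / (2 * l - μ) := by gcongr
    _ = _ := by ring

end Lyapunov

end EdgeObserver

theorem theorem4p1 {N n : ℕ} {m : Fin N → ℕ}
    (A : Matrix (Fin n) (Fin n) ℝ) (H : ∀ i, Matrix (Fin (m i)) (Fin n) ℝ)
    (G : SimpleGraph (Fin N)) [DecidableRel G.Adj] (a : Matrix (Fin N) (Fin N) ℝ)
    (ha : EdgeObserver.IsAdjacencyMatrix G a) (hG : G.Connected)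
    (hdet : EdgeObserver.IsDetectable A (EdgeObserver.stack H))
    (d : EdgeObserver.Design A H G a) :
    ∃ lam : ℝ, 0 < lam ∧ ∃ K : ℝ, 0 ≤ K ∧
      ∀ S : EdgeObserver.Signals N n, EdgeObserver.IsClosedLoop d S →
        (∀ i j, G.Adj i j → Filter.Tendsto (S.ts i j) Filter.atTop Filter.atTop) ∧
        ∀ i t, 0 ≤ t →
          ‖S.xhat i t - S.x t‖ ≤
            K * Real.sqrt (∑ j, ‖S.xhat j 0 - S.x 0‖ ^ 2
              + ∑ j, ∑ k ∈ G.neighborFinset j, S.rho j k 0) * Real.exp (-lam * t) := by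
  obtain ⟨l, hl, C, hC, hdec⟩ := EdgeObserver.exists_detPart_decay d ha
  obtain ⟨μ, hμ, hμl, K, hK, hund⟩ := EdgeObserver.exists_undetPart_decay ha hG hdet d hl hdec
  refine ⟨μ / 2, by positivity, √K + C, by positivity, fun S h =>
    ⟨fun i j hij => h.tendsto_ts ha hij, fun i t ht => ?_⟩⟩
  change ‖S.err i t‖ ≤ (√K + C) * √(S.initialSize G) * Real.exp (-(μ / 2) * t)
  have hR := h.initialSize_nonneg ha
  have h1 := hund S h i t ht
  have h2 := (hdec S h).1 i t ht
  have h3 : ‖d.undetPart i (S.err i t)‖ ≤ √K * √(S.initialSize G) * Real.exp (-(μ / 2) * t) := by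
    refine le_of_sq_le_sq ?_ (by positivity)
    refine h1.trans_eq ?_
    rw [mul_pow, mul_pow, Real.sq_sqrt hK, Real.sq_sqrt hR, sq (Real.exp _), ← Real.exp_add]
    congr 2
    ring
  have h4 : Real.exp (-l * t) ≤ Real.exp (-(μ / 2) * t) := by
    apply Real.exp_le_exp.2
    nlinarith
  have h5 : ‖S.err i t‖ ≤ ‖d.undetPart i (S.err i t)‖ + ‖d.detPart i (S.err i t)‖ := by
    conv_lhs => rw [← d.add_eq i (S.err i t)]
    refine (norm_add_le _ _).trans_eq ?_
    rw [(d.U_basis i).norm_apply, (d.D_basis i).norm_apply]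
  calc _ ≤ _ := h5
    _ ≤ √K * √(S.initialSize G) * Real.exp (-(μ / 2) * t)
        + C * √(S.initialSize G) * Real.exp (-(μ / 2) * t) := by
      refine add_le_add h3 (h2.trans ?_)
      gcongr
    _ = _ := by ring
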